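/- Let $\varphi_k(t)=\sqrt{k+1/2}\,(2^kk!)^{-1}\frac{d^k}{dt^k}[(t^2-1)^k]$, $k=0,1,2,\dots$, be the Legendre polynomials, orthonormal on $[-1,1]$; let $L_2=L_2([-1,1]^2)$ with inner product $\langle\cdot,\cdot\rangle$, let $\varphi_{k,j}(t,\tau)=\varphi_k(t)\varphi_j(\tau)$, and let $\underline k=\max\{1,k\}$. For $1\le s<\infty$ and $\mu>0$ let $L^\mu_{s,2}$ be the class of all $f\in L_2$ with $\|f\|_{s,\mu}:=\big(\sum_{k,j=0}^\infty(\underline k\,\underline j)^{s\mu}|\langle f,\varphi_{k,j}\rangle|^s\big)^{1/s}\le1$. For an integer $r\ge1$ the mixed derivative of $f$ is the $L_2$-sum $f^{(r,r)}=\sum_{k,j\ge r}\langle f,\varphi_{k,j}\rangle\varphi_k^{(r)}(t)\varphi_j^{(r)}(\tau)$. Let $1\le p\le\infty$ and $0<\delta<1$. For a finite set $\Omega$ of pairs of integers $(k,j)$, $k,j\ge r$, and an arbitrary mapping $\psi:\mathbb R^{\Omega}\to L_2$ put $$\varepsilon_\delta(\psi,\Omega)=\sup_{f\in L^\mu_{s,2}}\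 \sup_{y}\ \big\|f^{(r,r)}-\psi\big((y_{k,j})_{(k,j)\in\Omega}\big)\big\|_{L_2},$$ where $y=(y_{k,j})_{k,j\ge0}$ runs over all sequences with $\big\|(\langle f,\varphi_{k,j}\rangle-y_{k,j})_{k,j}\big\|_{\ell_p}\le\delta$. The minimal radius of Galerkin information $R_{N,\delta}=R^{(r,r)}_{N,\delta}(L^\mu_{s,2},L_2,\ell_p)$ is the infimum of $\varepsilon_\delta(\psi,\Omega)$ over all $\Omega$ with $\operatorname{card}\Omega\le N$ and all $\psi$. The truncation method is $\mathcal D_n^{(r,r)}y=\sum_{(k,j)\in\Gamma_n}y_{k,j}\varphi_k^{(r)}(t)\varphi_j^{(r)}(\tau)$ on the hyperbolic cross $\Gamma_n=\{(k,j):kj\le rn-1,\ r\le k,j\le n-1\}$. **Theorem.** Let $r\ge1$ be an integer, $1\le s<\infty$, $\mu>2r-1/s+1/2$, $1\le p\le\infty$ (with $1/\infty=0$). Then the series for $f^{(r,r)}$ converges (unconditionally) in $L_2$ for every $f\in L^\mu_{s,2}$. Put $\kappa=\mu-1/p+1/s$, $\alpha=\mu-2r+1/s-1/2$, $X_\delta=\big(\delta^{-1}\ln^\mu\frac1\delta\big)^{1/\kappa}$,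 $Y_\delta=\big(\delta^{-1}\ln^{1/p-1/s}\frac1\delta\big)^{1/\kappa}$. (i) For all $0<a\le b$ there are $c,C>0$ and $\delta_0\in(0,1)$ such that for all $0<\delta\le\delta_0$ and all integers $N$ with $aX_\delta\le N\le bX_\delta$ $$c\,N^{-\mu+2r-1/s+1/2}\le R_{N,\delta}\le C\,N^{-\mu+2r-1/s+1/2}\ln^{\mu-2r+1}N$$ and $$c\,\Big(\delta\ln^{-\mu}\tfrac1\delta\Big)^{\alpha/\kappa}\le R_{N,\delta}\le C\,\Big(\delta\ln^{1/s-1/p}\tfrac1\delta\Big)^{\alpha/\kappa}\ln^{3/2-1/s}\tfrac1\delta .$$ (ii) The upper bound is realized by the truncation method with $n\asymp Y_\delta$. That is, for all $0<a\le b$ there are $C>0$ and $\delta_0\in(0,1)$ such that for all $0<\delta\le\delta_0$ and all integers $n$ with $aY_\delta\le n\le bY_\delta$ $$\varepsilon_\delta(\mathcal D_n^{(r,r)},\Gamma_n)\le C\,\Big(\delta\ln^{1/s-1/p}\tfrac1\delta\Big)^{\alpha/\kappa}\ln^{3/2-1/s}\tfrac1\delta .$$ Moreover, for all $0<a\le b$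 there are $0<a'\le b'$, $C>0$ and $\delta_0\in(0,1)$ such that for all $0<\delta\le\delta_0$ there is an integer $n$ with $a'Y_\delta\le n\le b'Y_\delta$, and for all integers $N$ with $aX_\delta\le N\le bX_\delta$ every such $n$ satisfies $\operatorname{card}\Gamma_n\le N$ and $\varepsilon_\delta(\mathcal D_n^{(r,r)},\Gamma_n)\le C\,N^{-\mu+2r-1/s+1/2}\ln^{\mu-2r+1}N$. In all parts the constants may depend only on $r,s,\mu,p$ and on $a,b$. -/

import Mathlib

open MeasureTheory
open scoped ENNReal

noncomputable section

namespace GalerkinInfo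

/-- Lebesgue measure on the square `Q = [-1,1]²`. -/
def measQ : Measure (ℝ × ℝ) :=
  volume.restrict (Set.Icc (-1 : ℝ) 1 ×ˢ Set.Icc (-1 : ℝ) 1)

/-- The space `L₂(Q)` of real square-integrable functions on `Q = [-1,1]²`. -/
abbrev L2Q : Type := Lp ℝ 2 measQ

/-- The Legendre polynomials, orthonormal on `[-1,1]`:
`φ_k(t) = √(k+1/2) (2^k k!)⁻¹ (d/dt)^k [(t²-1)^k]`. -/
def legendre (k : ℕ) : Polynomial ℝ :=
  Polynomial.C (Real.sqrt ((k : ℝ) + 1 / 2) * ((2 : ℝ) ^ k * (k.factorial : ℝ))⁻¹) *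
    Polynomial.derivative^[k] ((Polynomial.X ^ 2 - 1) ^ k)

/-- The function `(t,τ) ↦ φ_k^{(r)}(t) φ_j^{(r)}(τ)`, with `q = (k,j)`. -/
def legendreTensorFun (r : ℕ) (q : ℕ × ℕ) (x : ℝ × ℝ) : ℝ :=
  (Polynomial.derivative^[r] (legendre q.1)).eval x.1 *
    (Polynomial.derivative^[r] (legendre q.2)).eval x.2

theorem memLp_legendreTensorFun (r : ℕ) (q : ℕ × ℕ) :
    MemLp (legendreTensorFun r q) 2 measQ := by
  have hc : Continuous (legendreTensorFun r q) := by
    unfold legendreTensorFun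
    fun_prop
  have hK : IsCompact (Set.Icc (-1 : ℝ) 1 ×ˢ Set.Icc (-1 : ℝ) 1) :=
    isCompact_Icc.prod isCompact_Icc
  have hfin : IsFiniteMeasure measQ := by
    refine ⟨?_⟩
    rw [measQ, Measure.restrict_apply_univ]
    exact hK.measure_lt_top
  obtain ⟨C, hC⟩ := hK.exists_bound_of_continuousOn hc.continuousOn
  refine MemLp.of_bound hc.aestronglyMeasurable C ?_
  exact (ae_restrict_iff' (measurableSet_Icc.prod measurableSet_Icc)).2
    (Filter.Eventually.of_forall hC)

/-- The element `φ_k^{(r)} ⊗ φ_j^{(r)}` of `L₂(Q)`, with `q = (k,j)`; for `r = 0` this is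
`φ_{k,j}`. -/
def legendreTensor (r : ℕ) (q : ℕ × ℕ) : L2Q :=
  (memLp_legendreTensorFun r q).toLp (legendreTensorFun r q)

/-- The Fourier-Legendre coefficient `⟨f, φ_{k,j}⟩`, with `q = (k,j)`. -/
def coeff (f : L2Q) (q : ℕ × ℕ) : ℝ := inner ℝ f (legendreTensor 0 q)

/-- The terms `(k_ j_)^{sμ} |⟨f, φ_{k,j}⟩|^s`, where `k_ = max 1 k`. -/
def normTerm (s μ : ℝ) (f : L2Q) (q : ℕ × ℕ) : ℝ :=
  ((max 1 q.1 : ℕ) * (max 1 q.2 : ℕ) : ℝ) ^ (s * μ) * |coeff f q| ^ s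

/-- The space `L^μ_{s,2}(Q)`. -/
def space (s μ : ℝ) : Set L2Q := {f | Summable (normTerm s μ f)}

/-- The norm `‖f‖_{s,μ}` (meaningful for `f ∈ space s μ`). -/
def smoothNorm (s μ : ℝ) (f : L2Q) : ℝ := (∑' q, normTerm s μ f q) ^ (1 / s)

/-- The class `L^μ_{s,2}`: the unit ball of the space. -/
def unitClass (s μ : ℝ) : Set L2Q := {f | f ∈ space s μ ∧ smoothNorm s μ f ≤ 1}

/-- The terms `⟨f, φ_{k,j}⟩ φ_k^{(r)} ⊗ φ_j^{(r)}`, `k, j ≥ r`, of the series for `f^{(r,r)}`. -/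
def derivTerm (r : ℕ) (f : L2Q) (q : {q : ℕ × ℕ // r ≤ q.1 ∧ r ≤ q.2}) : L2Q :=
  coeff f q.1 • legendreTensor r q.1

/-- The mixed derivative `f^{(r,r)} = ∑_{k,j ≥ r} ⟨f, φ_{k,j}⟩ φ_k^{(r)} ⊗ φ_j^{(r)}`,
as a series in `L₂(Q)`. -/
def mixedDeriv (r : ℕ) (f : L2Q) : L2Q := ∑' q, derivTerm r f q

/-- `y` is a perturbation of the sequence `x` of level `δ` in the metric of `ℓ_p`. -/
def IsPerturbation (p : ℝ≥0∞) (δ : ℝ) (x y : ℕ × ℕ → ℝ) : Prop :=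
  ∃ ξ : lp (fun _ : ℕ × ℕ => ℝ) p, (∀ q, ξ q = x q - y q) ∧ ‖ξ‖ ≤ δ

/-- The information vector `G(Ω, y) = (y_{k,j})_{(k,j) ∈ Ω}`. -/
def info (Ω : Finset (ℕ × ℕ)) (y : ℕ × ℕ → ℝ) : Ω → ℝ := fun q => y q

/-- The error on the class `L^μ_{s,2}`, in the metric of `L₂(Q)`, of an algorithm
`ψ` using the perturbed coefficients with indices in `Ω`. -/
def algError (r : ℕ) (s μ : ℝ) (p : ℝ≥0∞) (δ : ℝ) (Ω : Finset (ℕ × ℕ))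
    (ψ : (Ω → ℝ) → L2Q) : ℝ≥0∞ :=
  ⨆ f ∈ unitClass s μ, ⨆ (y : ℕ × ℕ → ℝ) (_ : IsPerturbation p δ (coeff f) y),
    ‖mixedDeriv r f - ψ (info Ω y)‖ₑ

/-- The minimal radius of Galerkin information `R_{N,δ}^{(r,r)}(L^μ_{s,2}, L₂, ℓ_p)`: the infimum
over all finite sets `Ω` of at most `N` indices `(k,j)`, `k, j ≥ r`, and over all mappings
`ψ : ℝ^Ω → L₂(Q)`. -/
def minimalRadius (r : ℕ) (s μ : ℝ) (p : ℝ≥0∞) (δ : ℝ) (N : ℕ) : ℝ≥0∞ :=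
  ⨅ (Ω : Finset (ℕ × ℕ)) (_ : ∀ q ∈ Ω, r ≤ q.1 ∧ r ≤ q.2) (_ : Ω.card ≤ N)
    (ψ : (Ω → ℝ) → L2Q), algError r s μ p δ Ω ψ

/-- The hyperbolic cross `Γ_n = {(k,j) : kj ≤ rn - 1, k, j = r, …, n-1}`. -/
def hypCross (r n : ℕ) : Finset (ℕ × ℕ) :=
  (Finset.Ico r n ×ˢ Finset.Ico r n).filter (fun q => q.1 * q.2 + 1 ≤ r * n)

/-- The truncation method `D_n^{(r,r)}`, as an algorithm on the information given by `Γ_n`. -/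
def truncation (r n : ℕ) (v : hypCross r n → ℝ) : L2Q :=
  ∑ q : hypCross r n, v q • legendreTensor r q.1

/-- The exponent `μ - 1/p + 1/s` (with `1/∞ = 0`). -/
def kappa (s μ : ℝ) (p : ℝ≥0∞) : ℝ := μ - (1 / p).toReal + 1 / s

/-- `(δ⁻¹ ln^μ (1/δ))^{1/(μ - 1/p + 1/s)}`: the order of the number `N` of coefficients. -/
def orderN (s μ : ℝ) (p : ℝ≥0∞) (δ : ℝ) : ℝ :=
  (δ⁻¹ * Real.log (1 / δ) ^ μ) ^ (1 / kappa s μ p)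

/-- `(δ⁻¹ ln^{1/p-1/s} (1/δ))^{1/(μ - 1/p + 1/s)}`: the order of the parameter `n`. -/
def orderTrunc (s μ : ℝ) (p : ℝ≥0∞) (δ : ℝ) : ℝ :=
  (δ⁻¹ * Real.log (1 / δ) ^ ((1 / p).toReal - 1 / s)) ^ (1 / kappa s μ p)

/-- `N^{-μ+2r-1/s+1/2}`. -/
def lowerInN (r : ℕ) (s μ : ℝ) (N : ℕ) : ℝ :=
  (N : ℝ) ^ (-μ + 2 * r - 1 / s + 1 / 2)

/-- `N^{-μ+2r-1/s+1/2} ln^{μ-2r+1} N`. -/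
def upperInN (r : ℕ) (s μ : ℝ) (N : ℕ) : ℝ :=
  (N : ℝ) ^ (-μ + 2 * r - 1 / s + 1 / 2) * Real.log N ^ (μ - 2 * r + 1)

/-- `(δ ln^{-μ} (1/δ))^{(μ-2r+1/s-1/2)/(μ-1/p+1/s)}`. -/
def lowerInDelta (r : ℕ) (s μ : ℝ) (p : ℝ≥0∞) (δ : ℝ) : ℝ :=
  (δ * Real.log (1 / δ) ^ (-μ)) ^ ((μ - 2 * r + 1 / s - 1 / 2) / kappa s μ p)

/-- `(δ ln^{1/s-1/p} (1/δ))^{(μ-2r+1/s-1/2)/(μ-1/p+1/s)} ln^{3/2-1/s} (1/δ)`. -/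
def upperInDelta (r : ℕ) (s μ : ℝ) (p : ℝ≥0∞) (δ : ℝ) : ℝ :=
  (δ * Real.log (1 / δ) ^ (1 / s - (1 / p).toReal)) ^
      ((μ - 2 * r + 1 / s - 1 / 2) / kappa s μ p) *
    Real.log (1 / δ) ^ (3 / 2 - 1 / s)

end GalerkinInfo

end

/-! The mixed derivatives of the basis functions are not orthogonal, so the upper bound uses only
the triangle inequality and the norms `‖φ_k^{(r)}‖ = O(k^{2r-1/2})`. Put `w = 2r - 1/2`, `M = rn`
and `α = μ - 2r + 1/s - 1/2`; the hypothesis on `μ` says exactly that `α > 0`. The error of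
truncation splits into two parts. The discarded terms have `kj ≥ M`. They are cut into dyadic blocks
of `kj`; Hölder's inequality on each block, with the count `O(x ln x)` of lattice points under the
hyperbola `kj ≤ x`, gives a series that converges geometrically and sums to `O(M^{-α} ln^{1-1/s} M)`
(`sum_hyperbolic_tail_le`). The noise on the cross is at most a constant times `δ M^w (card
Γ_n)^{1-1/p}`, again by Hölder (`sum_abs_le_of_norm_le`). The choice `n ≍ Y_δ` makes the two parts
equal in order (`eventually_truncation_error_le`). Since `card Γ_n = O(n ln n)` and `X_δ = Y_δ ln
(1/δ)`, a suitable multiple of `Y_δ` fits within `N` coefficients.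

For the lower bound, an element `f` of the class whose coefficients vanish on `Ω` cannot be told
from `-f`, so the error is at least `‖f^{(r,r)}‖`, even for exact data (`le_algError`). Take `f = t
∑ φ_{k,r}` over at least `N` indices `k ≍ N` avoiding `Ω`, with `t ≍ N^{-μ-1/s}`. The derivatives
`φ_k^{(r)}` have values of order `k^{2r+1/2}` at the endpoint `1`, all positive, so their sum `P`
satisfies `P(1) ≥ c N^{2r+3/2}`. Nikolskii's inequality `P(1)² ≤ (n²/2) ‖P‖²` for degree less than
`n ≍ N` turns this into `‖P‖ ≥ c N^{2r+1/2}` (`norm_sum_legendreTensor_ge`), whence the lower bound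
`c N^{-α}`. -/

section

/-! ### Legendre polynomials in one variable: orthonormality, endpoint values, norms of derivatives.
-/

open Polynomial

namespace GalerkinInfo

/-- The linear functional `P ↦ ∫_{-1}^1 P`. -/
noncomputable def intI : ℝ[X] →ₗ[ℝ] ℝ where
  toFun P := ∫ x in (-1 : ℝ)..1, P.eval x
  map_add' P Q := by
    simp only [eval_add]
    exact intervalIntegral.integral_add (P.continuous.intervalIntegrable _ _)
      (Q.continuous.intervalIntegrable _ _)
  map_smul' c P := by
    simp only [eval_smul, smul_eq_mul, RingHom.id_apply, intervalIntegral.integral_const_mul]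

theorem intI_apply (P : ℝ[X]) : intI P = ∫ x in (-1 : ℝ)..1, P.eval x := rfl

theorem intI_derivative (P : ℝ[X]) : intI (derivative P) = P.eval 1 - P.eval (-1) := by
  rw [intI_apply]
  exact intervalIntegral.integral_eq_sub_of_hasDerivAt (fun x _ => P.hasDerivAt x)
    ((derivative P).continuous.intervalIntegrable _ _)

theorem intI_derivative_mul (P Q : ℝ[X]) :
    intI (derivative P * Q) =
      P.eval 1 * Q.eval 1 - P.eval (-1) * Q.eval (-1) - intI (P * derivative Q) := by
  have h := intI_derivative (P * Q)
  rw [derivative_mul, map_add, eval_mul, eval_mul] at h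
  linarith

theorem intI_mul_self_nonneg (P : ℝ[X]) : 0 ≤ intI (P * P) := by
  rw [intI_apply]
  refine intervalIntegral.integral_nonneg (by norm_num) fun x _ => ?_
  rw [eval_mul]
  exact mul_self_nonneg _

/-- Each differentiation removes at most one factor `X² - 1`, so one is left; this kills the
boundary terms when Rodrigues' formula is integrated by parts. -/
theorem eval_iterate_derivative_eq_zero_of_lt {k i : ℕ} (hi : i < k) {x : ℝ} (hx : x ^ 2 = 1) :
    (derivative^[i] ((X ^ 2 - 1 : ℝ[X]) ^ k)).eval x = 0 := by
  obtain ⟨Q, hQ⟩ := pow_sub_dvd_iterate_derivative_pow (X ^ 2 - 1 : ℝ[X]) k i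
  rw [hQ, eval_mul, eval_pow]
  have : (X ^ 2 - 1 : ℝ[X]).eval x = 0 := by simp [hx]
  rw [this, zero_pow (by omega), zero_mul]

theorem intI_iterate_derivative_mul (k i : ℕ) (hi : i ≤ k) (Q : ℝ[X]) :
    intI (derivative^[i] ((X ^ 2 - 1 : ℝ[X]) ^ k) * Q) =
      (-1) ^ i * intI ((X ^ 2 - 1 : ℝ[X]) ^ k * derivative^[i] Q) := by
  induction i generalizing Q with
  | zero => simp
  | succ i ih =>
    rw [Function.iterate_succ_apply', intI_derivative_mul,
      eval_iterate_derivative_eq_zero_of_lt (by omega) (by norm_num),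
      eval_iterate_derivative_eq_zero_of_lt (by omega) (by norm_num), ih (by omega),
      Function.iterate_succ_apply]
    ring

theorem intI_legendre_mul_eq_zero {k : ℕ} {Q : ℝ[X]} (hQ : Q.degree < k) :
    intI (legendre k * Q) = 0 := by
  rw [legendre, mul_assoc, ← smul_eq_C_mul, map_smul, intI_iterate_derivative_mul k k le_rfl,
    iterate_derivative_eq_zero_of_degree_lt hQ]
  simp

theorem coeff_legendre (k m : ℕ) :
    (legendre k).coeff m = Real.sqrt ((k : ℝ) + 1 / 2) * ((2 : ℝ) ^ k * (k.factorial : ℝ))⁻¹ *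
      ((m + k).descFactorial k * ((X ^ 2 - 1 : ℝ[X]) ^ k).coeff (m + k)) := by
  rw [legendre, coeff_C_mul, coeff_iterate_derivative, nsmul_eq_mul]

theorem X_sq_sub_one_monic (k : ℕ) : ((X ^ 2 - 1 : ℝ[X]) ^ k).Monic :=
  (monic_X_pow_sub_C (1 : ℝ) two_ne_zero).pow k

theorem natDegree_X_sq_sub_one_pow (k : ℕ) : ((X ^ 2 - 1 : ℝ[X]) ^ k).natDegree = k * 2 := by
  have := natDegree_X_pow_sub_C (R := ℝ) (n := 2) (r := 1)
  rw [natDegree_pow]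
  simpa using Or.inl this

theorem coeff_legendre_of_lt {k m : ℕ} (h : k < m) : (legendre k).coeff m = 0 := by
  rw [coeff_legendre, coeff_eq_zero_of_natDegree_lt (by rw [natDegree_X_sq_sub_one_pow]; omega)]
  simp

theorem coeff_legendre_self_pos (k : ℕ) : 0 < (legendre k).coeff k := by
  rw [coeff_legendre]
  have h : ((X ^ 2 - 1 : ℝ[X]) ^ k).coeff (k + k) = 1 := by
    have := (X_sq_sub_one_monic k).coeff_natDegree
    rwa [natDegree_X_sq_sub_one_pow, mul_two] at this
  rw [h]
  have : 0 < (k + k).descFactorial k := Nat.descFactorial_pos.2 (by omega)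
  positivity

theorem degree_legendre_lt (k : ℕ) : (legendre k).degree < (k + 1 : ℕ) :=
  degree_lt_iff_coeff_zero _ _ |>.2 fun m hm => coeff_legendre_of_lt (by omega)

/-- The value at `1` of the derivatives of the orthonormal Legendre polynomials. -/
theorem eval_one_iterate_derivative_legendre (k r : ℕ) :
    (derivative^[r] (legendre k)).eval 1 =
      Real.sqrt ((k : ℝ) + 1 / 2) * ((k + r).choose r * k.descFactorial r / 2 ^ r) := by
  have hW : (X ^ 2 - 1 : ℝ[X]) ^ k = (X - C 1) ^ k * (X + C 1) ^ k := by
    rw [← mul_pow]; congr 1; simp; ring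
  -- In the Leibniz expansion at `1` only one term survives: exactly `k` derivatives must fall on
  -- `(X - 1)^k`. Fewer leave a zero at `1`, more give the zero polynomial.
  rw [legendre, iterate_derivative_C_mul, ← Function.iterate_add_apply, hW,
    iterate_derivative_mul, eval_mul, eval_C, eval_finsetSum,
    Finset.sum_eq_single_of_mem r (by simp)]
  · rw [Nat.add_comm r k, Nat.add_sub_cancel, iterate_derivative_X_sub_pow_self,
      iterate_derivative_X_add_pow]
    simp only [eval_mul, eval_pow, eval_add, eval_X, eval_C, eval_natCast, nsmul_eq_mul]
    rcases le_or_gt r k with h | h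
    · have h2 : (2 : ℝ) ^ k = 2 ^ (k - r) * 2 ^ r := by rw [← pow_add]; congr 1; omega
      rw [h2]
      have : (k.factorial : ℝ) ≠ 0 := by positivity
      norm_num
      field_simp
    · simp [Nat.descFactorial_eq_zero_iff_lt.2 h]
  · intro i hi hir
    rw [iterate_derivative_X_sub_pow, iterate_derivative_X_add_pow]
    simp only [Finset.mem_range] at hi
    rcases lt_or_gt_of_ne hir with h | h
    · rw [Nat.descFactorial_eq_zero_iff_lt.2 (by omega : k < r + k - i)]; simp
    · simp [eval_pow, zero_pow (by omega : k - (r + k - i) ≠ 0)]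

theorem eval_one_legendre (k : ℕ) : (legendre k).eval 1 = Real.sqrt ((k : ℝ) + 1 / 2) := by
  simpa using eval_one_iterate_derivative_legendre k 0

theorem eval_neg_one_legendre (k : ℕ) :
    (legendre k).eval (-1) = (-1) ^ k * Real.sqrt ((k : ℝ) + 1 / 2) := by
  have hW : (X ^ 2 - 1 : ℝ[X]) ^ k = (X - C 1) ^ k * (X + C 1) ^ k := by
    rw [← mul_pow]; congr 1; simp; ring
  rw [legendre, hW, iterate_derivative_mul, eval_mul, eval_C, eval_finsetSum,
    Finset.sum_eq_single_of_mem k (by simp)]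
  · rw [iterate_derivative_X_sub_pow, iterate_derivative_X_add_pow]
    simp only [eval_mul, eval_pow, eval_sub, eval_X, eval_C, eval_natCast, nsmul_eq_mul, Nat.sub_self, Nat.descFactorial_self, Nat.choose_self, Nat.sub_zero,
      Nat.descFactorial_zero, pow_zero, eval_one]
    have : (k.factorial : ℝ) ≠ 0 := by positivity
    have h2 : (-1 - 1 : ℝ) = (-1) * 2 := by norm_num
    rw [h2, mul_pow]
    simp only [Nat.cast_one]
    field_simp
  · intro i hi hik
    rw [iterate_derivative_X_sub_pow, iterate_derivative_X_add_pow]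
    simp only [Finset.mem_range] at hi
    simp [zero_pow (by omega : k - i ≠ 0)]

/-- Integrate `1 · φ_k²` by parts. The boundary contributes `2k + 1`, and `xφ_k' - kφ_k` has degree
below `k`, hence is orthogonal to `φ_k`; so `(2k + 1) ∫ φ_k² = 2k + 1`. -/
theorem intI_legendre_mul_self (k : ℕ) : intI (legendre k * legendre k) = 1 := by
  have h := intI_derivative_mul X (legendre k * legendre k)
  simp only [derivative_X, one_mul, eval_X, eval_mul, eval_one_legendre, eval_neg_one_legendre,
    derivative_mul] at h
  have hlow : (X * derivative (legendre k) - C (k : ℝ) * legendre k).degree <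
      (k : WithBot ℕ) := by
    refine (degree_lt_iff_coeff_zero _ _).2 fun m hm => ?_
    rw [coeff_sub, coeff_C_mul]
    rcases m with _ | m
    · obtain rfl : k = 0 := by omega
      simp
    · rw [coeff_X_mul, coeff_derivative]
      rcases hm.eq_or_lt with h | h
      · rw [h]; push_cast; ring
      · rw [coeff_legendre_of_lt h]; simp
  have h0 := intI_legendre_mul_eq_zero hlow
  have e : X * (derivative (legendre k) * legendre k + legendre k * derivative (legendre k)) =
      (2 : ℝ) • (legendre k * (X * derivative (legendre k) - C (k : ℝ) * legendre k)) +
        (2 * (k : ℝ)) • (legendre k * legendre k) := by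
    simp only [smul_eq_C_mul, C_mul]
    have : (C 2 : ℝ[X]) = 2 := rfl
    rw [this]; ring
  rw [e, map_add, map_smul, map_smul, h0] at h
  have hs : Real.sqrt ((k : ℝ) + 1 / 2) * Real.sqrt ((k : ℝ) + 1 / 2) = k + 1 / 2 :=
    Real.mul_self_sqrt (by positivity)
  have hp : ((-1 : ℝ) ^ k * Real.sqrt ((k : ℝ) + 1 / 2)) *
      ((-1) ^ k * Real.sqrt ((k : ℝ) + 1 / 2)) = k + 1 / 2 := by
    rw [mul_mul_mul_comm, hs, ← mul_pow]; norm_num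
  rw [hs, hp] at h
  simp only [smul_eq_mul] at h
  have : (2 * (k : ℝ) + 1) * intI (legendre k * legendre k) = (2 * k + 1) * 1 := by linarith
  exact mul_left_cancel₀ (by positivity) this

theorem intI_legendre_mul_legendre (k l : ℕ) :
    intI (legendre k * legendre l) = if k = l then 1 else 0 := by
  split_ifs with h
  · rw [h, intI_legendre_mul_self]
  · rcases lt_or_gt_of_ne h with h | h
    · rw [mul_comm]
      exact intI_legendre_mul_eq_zero ((degree_legendre_lt k).trans_le (by exact_mod_cast h))
    · exact intI_legendre_mul_eq_zero ((degree_legendre_lt l).trans_le (by exact_mod_cast h))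

/-- A polynomial of degree less than `n` is the sum of its Fourier-Legendre series. -/
theorem eq_sum_legendre {n : ℕ} {P : ℝ[X]} (hP : P.degree < n) :
    P = ∑ l ∈ Finset.range n, intI (P * legendre l) • legendre l := by
  -- Any expansion will do: orthonormality forces its coefficients. Existence follows by cancelling
  -- leading coefficients.
  suffices h : ∃ c : ℕ → ℝ, P = ∑ l ∈ Finset.range n, c l • legendre l by
    obtain ⟨c, hc⟩ := h
    nth_rewrite 1 [hc]
    refine Finset.sum_congr rfl fun l hl => ?_
    congr 1
    rw [hc, Finset.sum_mul, map_sum]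
    simp only [smul_mul_assoc, map_smul, intI_legendre_mul_legendre, smul_eq_mul, mul_ite,
      mul_one, mul_zero]
    rw [Finset.sum_ite_eq' _ _ c, if_pos hl]
  induction n generalizing P with
  | zero =>
    exact ⟨0, by simpa using hP⟩
  | succ n ih =>
    set a := P.coeff n / (legendre n).coeff n with ha
    have h : (P - a • legendre n).degree < n := by
      refine (degree_lt_iff_coeff_zero _ _).2 fun m hm => ?_
      rw [coeff_sub, coeff_smul, smul_eq_mul]
      rcases hm.eq_or_lt with h | h
      · rw [← h, ha, div_mul_cancel₀ _ (coeff_legendre_self_pos n).ne', sub_self]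
      · rw [coeff_legendre_of_lt h, (degree_lt_iff_coeff_zero _ _).1 hP m (by omega)]
        simp
    obtain ⟨c, hc⟩ := ih h
    refine ⟨fun l => if l = n then a else c l, ?_⟩
    simp only [Finset.sum_range_succ, if_true]
    rw [← sub_eq_iff_eq_add, hc]
    refine Finset.sum_congr rfl fun l hl => ?_
    rw [if_neg (Finset.mem_range.1 hl).ne]

/-- Parseval's identity for polynomials. -/
theorem intI_mul_self_eq_sum {n : ℕ} {P : ℝ[X]} (hP : P.degree < n) :
    intI (P * P) = ∑ l ∈ Finset.range n, intI (P * legendre l) ^ 2 := by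
  nth_rewrite 2 [eq_sum_legendre hP]
  rw [Finset.mul_sum, map_sum]
  refine Finset.sum_congr rfl fun l _ => ?_
  rw [mul_smul_comm, map_smul, smul_eq_mul, sq]

theorem sum_range_add_half (n : ℕ) : ∑ l ∈ Finset.range n, ((l : ℝ) + 1 / 2) = n ^ 2 / 2 := by
  induction n with
  | zero => simp
  | succ n ih => rw [Finset.sum_range_succ, ih]; push_cast; ring

/-- Nikolskii's inequality between an endpoint value and the norm in `L₂(-1,1)`. -/
theorem sq_eval_one_le {n : ℕ} {P : ℝ[X]} (hP : P.degree < n) :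
    P.eval 1 ^ 2 ≤ n ^ 2 / 2 * intI (P * P) := by
  have h1 : P.eval 1 = ∑ l ∈ Finset.range n,
      intI (P * legendre l) * Real.sqrt ((l : ℝ) + 1 / 2) := by
    nth_rewrite 1 [eq_sum_legendre hP]
    rw [eval_finsetSum]
    simp only [eval_smul, eval_one_legendre, smul_eq_mul]
  -- Cauchy–Schwarz; the factor `n²/2` is the sum of the squares `φ_l(1)² = l + 1/2`.
  rw [h1]
  refine (Finset.sum_mul_sq_le_sq_mul_sq _ _ _).trans_eq ?_
  rw [← intI_mul_self_eq_sum hP, ← sum_range_add_half, mul_comm]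
  congr 1
  exact Finset.sum_congr rfl fun l _ => Real.sq_sqrt (by positivity)

/-- For `l < k`, moving the derivative onto `φ_l` leaves an integral that vanishes by orthogonality,
so only two boundary terms remain, each at most `φ_k(1) φ_l(1) ≤ k + 1/2` in modulus. For `l = k`
the boundary terms cancel by parity. -/
theorem abs_intI_derivative_legendre_mul_le {k l : ℕ} (h : l ≤ k) :
    |intI (derivative (legendre k) * legendre l)| ≤ 2 * k + 1 := by
  rcases h.eq_or_lt with rfl | h
  · have h2 := intI_derivative_mul (legendre l) (legendre l)
    rw [mul_comm (legendre l) (derivative _)] at h2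
    simp only [eval_one_legendre, eval_neg_one_legendre] at h2
    have hp : ((-1 : ℝ) ^ l * Real.sqrt ((l : ℝ) + 1 / 2)) *
        ((-1) ^ l * Real.sqrt ((l : ℝ) + 1 / 2)) =
          Real.sqrt ((l : ℝ) + 1 / 2) * Real.sqrt ((l : ℝ) + 1 / 2) := by
      rw [mul_mul_mul_comm, ← mul_pow]; norm_num
    have : intI (derivative (legendre l) * legendre l) = 0 := by linarith
    rw [this, abs_zero]; positivity
  · have hd : (derivative (legendre l)).degree < k :=
      (degree_derivative_le.trans_lt (degree_legendre_lt l)).trans_le (by exact_mod_cast h)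
    rw [intI_derivative_mul, intI_legendre_mul_eq_zero hd, eval_one_legendre, eval_one_legendre,
      eval_neg_one_legendre, eval_neg_one_legendre, sub_zero]
    set u := Real.sqrt ((k : ℝ) + 1 / 2)
    set v := Real.sqrt ((l : ℝ) + 1 / 2)
    have huv : u * v ≤ k + 1 / 2 := by
      have : v ≤ u := Real.sqrt_le_sqrt (by gcongr)
      calc u * v ≤ u * u := by gcongr
        _ = k + 1 / 2 := Real.mul_self_sqrt (by positivity)
    calc |u * v - (-1) ^ k * u * ((-1) ^ l * v)|
        ≤ |u * v| + |(-1) ^ k * u * ((-1) ^ l * v)| := abs_sub _ _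
      _ = u * v + u * v := by
          rw [abs_mul, abs_mul, abs_mul ((-1) ^ k), abs_mul ((-1) ^ l)]
          simp [abs_of_nonneg (Real.sqrt_nonneg _), u, v]
      _ ≤ 2 * k + 1 := by linarith

theorem degree_derivative_legendre_lt (k : ℕ) : (derivative (legendre k)).degree < k := by
  refine (degree_lt_iff_coeff_zero _ _).2 fun m hm => ?_
  rw [coeff_derivative, coeff_legendre_of_lt (by omega), zero_mul]

/-- The Fourier-Legendre coefficients of the derivative of order `r` of `φ_k` are
`O(k^{2r-1})`. -/
theorem exists_abs_intI_iterate_derivative_legendre_mul_le (r : ℕ) :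
    ∃ C : ℝ, 0 ≤ C ∧ ∀ k l : ℕ, l ≤ k →
      |intI (derivative^[r + 1] (legendre k) * legendre l)| ≤ C * (k : ℝ) ^ (2 * r + 1) := by
  induction r with
  | zero =>
    refine ⟨3, by norm_num, fun k l h => ?_⟩
    rcases Nat.eq_zero_or_pos k with rfl | hk
    · have h0 := degree_derivative_legendre_lt 0
      have : derivative (legendre 0) = 0 := by simpa using h0
      simp [this]
    · have : (1 : ℝ) ≤ k := by exact_mod_cast hk
      have h1 := abs_intI_derivative_legendre_mul_le h
      simp only [zero_add, Function.iterate_one, mul_zero, pow_one]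
      linarith
  | succ r ih =>
    obtain ⟨C, hC, h⟩ := ih
    refine ⟨3 * C, by positivity, fun k l hl => ?_⟩
    -- Expand `φ_k'` first and differentiate the expansion: `k` terms, each a coefficient `O(k)`
    -- times the inductive `O(k^{2r+1})`, so every extra derivative costs `k²`.
    have e : derivative^[r + 1 + 1] (legendre k) = ∑ m ∈ Finset.range k,
        intI (derivative (legendre k) * legendre m) • derivative^[r + 1] (legendre m) := by
      rw [Function.iterate_succ_apply]
      nth_rewrite 1 [eq_sum_legendre (degree_derivative_legendre_lt k)]
      rw [iterate_derivative_sum]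
      simp only [iterate_derivative_smul]
    rw [e, Finset.sum_mul, map_sum]
    refine (Finset.abs_sum_le_sum_abs _ _).trans ?_
    calc _ ≤ ∑ m ∈ Finset.range k, (3 * k : ℝ) * (C * (k : ℝ) ^ (2 * r + 1)) := by
            refine Finset.sum_le_sum fun m hm => ?_
            have hm := Finset.mem_range.1 hm
            have hk : (1 : ℝ) ≤ k := by exact_mod_cast (by omega : 1 ≤ k)
            rw [smul_mul_assoc, map_smul, smul_eq_mul, abs_mul]
            have h1 := abs_intI_derivative_legendre_mul_le hm.le
            refine mul_le_mul (by linarith) ?_ (abs_nonneg _) (by positivity)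
            rcases le_or_gt l m with hlm | hlm
            · refine (h m l hlm).trans ?_
              gcongr
            · have hd : (derivative^[r + 1] (legendre m)).degree < l := by
                refine (degree_lt_iff_coeff_zero _ _).2 fun i hi => ?_
                rw [coeff_iterate_derivative, coeff_legendre_of_lt (by omega), smul_zero]
              rw [mul_comm, intI_legendre_mul_eq_zero hd, abs_zero]
              positivity
      _ = _ := by
            rw [Finset.sum_const, Finset.card_range, nsmul_eq_mul]; ring

/-- `‖φ_k^{(r)}‖² = O(k^{4r-1})` in `L₂(-1,1)`. -/
theorem exists_intI_iterate_derivative_legendre_sq_le (r : ℕ) (hr : 1 ≤ r) :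
    ∃ C : ℝ, 0 ≤ C ∧ ∀ k : ℕ,
      intI (derivative^[r] (legendre k) * derivative^[r] (legendre k)) ≤
        C * (k : ℝ) ^ (4 * r - 1) := by
  obtain ⟨r, rfl⟩ := Nat.exists_eq_add_of_le' hr
  obtain ⟨C, hC, h⟩ := exists_abs_intI_iterate_derivative_legendre_mul_le r
  refine ⟨C ^ 2, by positivity, fun k => ?_⟩
  have hd : (derivative^[r + 1] (legendre k)).degree < k := by
    refine (degree_lt_iff_coeff_zero _ _).2 fun i hi => ?_
    rw [coeff_iterate_derivative, coeff_legendre_of_lt (by omega), smul_zero]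
  rw [intI_mul_self_eq_sum hd]
  calc _ ≤ ∑ l ∈ Finset.range k, (C * (k : ℝ) ^ (2 * r + 1)) ^ 2 := by
          refine Finset.sum_le_sum fun l hl => ?_
          rw [← sq_abs]
          have := h k l (Finset.mem_range.1 hl).le
          gcongr
    _ = _ := by
          rw [Finset.sum_const, Finset.card_range, nsmul_eq_mul,
            show 4 * (r + 1) - 1 = (2 * r + 1) * 2 + 1 by omega]
          ring

/-- `φ_k^{(r)}(1) ≥ c M^{2r+1/2}` for `k ≥ M + r`. -/
theorem le_eval_one_iterate_derivative_legendre {r M k : ℕ} (hk : M + r ≤ k) :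
    Real.sqrt M * ((M : ℝ) ^ (2 * r) / (r.factorial * 2 ^ r)) ≤
      (derivative^[r] (legendre k)).eval 1 := by
  rw [eval_one_iterate_derivative_legendre]
  have hMk : (M : ℝ) ≤ k := by exact_mod_cast (by omega : M ≤ k)
  have h1 : M ^ r ≤ (k + r).choose r * r.factorial := by
    rw [mul_comm, ← Nat.descFactorial_eq_factorial_mul_choose]
    refine le_trans ?_ (Nat.pow_sub_le_descFactorial _ _)
    exact Nat.pow_le_pow_left (by omega) _
  have h2 : M ^ r ≤ k.descFactorial r :=
    le_trans (Nat.pow_le_pow_left (by omega) _) (Nat.pow_sub_le_descFactorial _ _)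
  have h1' : (M : ℝ) ^ r ≤ (k + r).choose r * r.factorial := by exact_mod_cast h1
  have h2' : (M : ℝ) ^ r ≤ k.descFactorial r := by exact_mod_cast h2
  have hf : (0 : ℝ) < r.factorial := by positivity
  refine mul_le_mul (Real.sqrt_le_sqrt (by linarith)) ?_ (by positivity) (by positivity)
  rw [two_mul, pow_add, ← div_div, div_le_div_iff_of_pos_right (by positivity),
    div_le_iff₀ hf]
  calc (M : ℝ) ^ r * M ^ r ≤ ((k + r).choose r * r.factorial) * k.descFactorial r := by gcongr
    _ = _ := by ring

end GalerkinInfo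

end

/-! ### Tensor products in `L₂` of the square. -/

section

open Polynomial

namespace GalerkinInfo

theorem measQ_eq_prod : measQ =
    (volume.restrict (Set.Icc (-1 : ℝ) 1)).prod (volume.restrict (Set.Icc (-1 : ℝ) 1)) := by
  rw [measQ, Measure.volume_eq_prod, Measure.prod_restrict]

theorem integral_Icc_eval (P : ℝ[X]) : ∫ x in Set.Icc (-1 : ℝ) 1, P.eval x = intI P := by
  rw [intI_apply, intervalIntegral.integral_of_le (by norm_num), integral_Icc_eq_integral_Ioc]

theorem inner_legendreTensor (r r' : ℕ) (q q' : ℕ × ℕ) :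
    inner ℝ (legendreTensor r q) (legendreTensor r' q') =
      intI (derivative^[r] (legendre q.1) * derivative^[r'] (legendre q'.1)) *
        intI (derivative^[r] (legendre q.2) * derivative^[r'] (legendre q'.2)) := by
  have h : ∀ᵐ x ∂measQ, inner ℝ (legendreTensor r q x) (legendreTensor r' q' x) =
      (derivative^[r] (legendre q.1) * derivative^[r'] (legendre q'.1)).eval x.1 *
        (derivative^[r] (legendre q.2) * derivative^[r'] (legendre q'.2)).eval x.2 := by
    filter_upwards [(memLp_legendreTensorFun r q).coeFn_toLp,
      (memLp_legendreTensorFun r' q').coeFn_toLp] with x h1 h2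
    rw [legendreTensor, legendreTensor, h1, h2, real_inner_eq_re_inner]
    simp only [legendreTensorFun, RCLike.inner_apply, conj_trivial, RCLike.re_to_real, eval_mul]
    ring
  rw [L2.inner_def, integral_congr_ae h, measQ_eq_prod, ← integral_Icc_eval, ← integral_Icc_eval]
  exact integral_prod_mul
    (fun x => (derivative^[r] (legendre q.1) * derivative^[r'] (legendre q'.1)).eval x)
    (fun x => (derivative^[r] (legendre q.2) * derivative^[r'] (legendre q'.2)).eval x)

theorem inner_legendreTensor_zero (q q' : ℕ × ℕ) :
    inner ℝ (legendreTensor 0 q) (legendreTensor 0 q') = if q = q' then 1 else 0 := by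
  rw [inner_legendreTensor]
  simp only [Function.iterate_zero, id, intI_legendre_mul_legendre, Prod.ext_iff]
  split_ifs <;> simp_all

theorem coeff_sum (A : Finset (ℕ × ℕ)) (t : ℝ) (q : ℕ × ℕ) :
    coeff (∑ a ∈ A, t • legendreTensor 0 a) q = if q ∈ A then t else 0 := by
  rw [coeff, sum_inner]
  simp only [real_inner_smul_left, inner_legendreTensor_zero, mul_ite, mul_one, mul_zero]
  rw [Finset.sum_ite_eq' A q fun _ => t]

theorem coeff_neg (f : L2Q) (q : ℕ × ℕ) : coeff (-f) q = -coeff f q := inner_neg_left _ _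

/-- By Fubini the squared norm is a product of two one-variable squared norms, each `O(k^{4r-1})`.
The exponent `2r - 1/2` is the weight `w` in the error estimates below. -/
theorem exists_norm_legendreTensor_le (r : ℕ) (hr : 1 ≤ r) :
    ∃ C : ℝ, 0 < C ∧ ∀ q : ℕ × ℕ,
      ‖legendreTensor r q‖ ≤ C * ((q.1 : ℝ) * q.2) ^ (2 * (r : ℝ) - 1 / 2) := by
  obtain ⟨C, hC, h⟩ := exists_intI_iterate_derivative_legendre_sq_le r hr
  refine ⟨C + 1, by positivity, fun q => ?_⟩
  refine abs_le_of_sq_le_sq' ?_ (by positivity) |>.2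
  rw [← real_inner_self_eq_norm_sq, inner_legendreTensor]
  have e : (((q.1 : ℝ) * q.2) ^ (2 * (r : ℝ) - 1 / 2)) ^ 2 =
      (q.1 : ℝ) ^ (4 * r - 1) * (q.2 : ℝ) ^ (4 * r - 1) := by
    rw [← Real.rpow_natCast, ← Real.rpow_mul (by positivity), ← mul_pow, ← Real.rpow_natCast]
    congr 1
    rw [Nat.cast_sub (by omega)]
    push_cast
    ring
  rw [mul_pow, e]
  calc _ ≤ (C * (q.1 : ℝ) ^ (4 * r - 1)) * (C * (q.2 : ℝ) ^ (4 * r - 1)) :=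
        mul_le_mul (h _) (h _) (intI_mul_self_nonneg _) (by positivity)
    _ = C ^ 2 * ((q.1 : ℝ) ^ (4 * r - 1) * (q.2 : ℝ) ^ (4 * r - 1)) := by ring
    _ ≤ _ := by gcongr; linarith

end GalerkinInfo

end

/-! ### Lattice points under a hyperbola and weighted tail sums. -/

namespace GalerkinInfo

/-- The column over `k` holds at most `K / k` points, and the columns sum to a harmonic number. -/
theorem card_le_of_mul_le_nat {K : ℕ} (S : Finset (ℕ × ℕ))
    (hS : ∀ q ∈ S, 1 ≤ q.1 ∧ 1 ≤ q.2 ∧ q.1 * q.2 ≤ K) :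
    (S.card : ℝ) ≤ K * (1 + Real.log K) := by
  have hmaps : Set.MapsTo Prod.fst (S : Set (ℕ × ℕ)) (Finset.Icc 1 K : Finset ℕ) := by
    intro q hq
    obtain ⟨h1, h2, h3⟩ := hS q hq
    exact Finset.mem_coe.2 (Finset.mem_Icc.2 ⟨h1, (Nat.le_mul_of_pos_right _ h2).trans h3⟩)
  have h1 : (S.card : ℝ) ≤ ∑ k ∈ Finset.Icc 1 K, (K : ℝ) * (k : ℝ)⁻¹ := by
    rw [Finset.card_eq_sum_card_fiberwise hmaps, Nat.cast_sum]
    refine Finset.sum_le_sum fun k hk => ?_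
    have hk1 : 1 ≤ k := (Finset.mem_Icc.1 hk).1
    have hc : (S.filter fun q => q.1 = k).card ≤ K / k := by
      have : (S.filter fun q => q.1 = k).card ≤ (Finset.Icc 1 (K / k)).card := by
        refine Finset.card_le_card_of_injOn Prod.snd (fun q hq => ?_) fun q hq q' hq' he => ?_
        · obtain ⟨hq, hqk⟩ := Finset.mem_filter.1 (Finset.mem_coe.1 hq)
          obtain ⟨-, h2, h3⟩ := hS q hq
          refine Finset.mem_coe.2 (Finset.mem_Icc.2 ⟨h2, ?_⟩)
          rw [Nat.le_div_iff_mul_le hk1, mul_comm, ← hqk]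
          exact h3
        · exact Prod.ext ((Finset.mem_filter.1 (Finset.mem_coe.1 hq)).2.trans
            (Finset.mem_filter.1 (Finset.mem_coe.1 hq')).2.symm) he
      simpa using this
    calc (((S.filter fun q => q.1 = k).card : ℕ) : ℝ) ≤ ((K / k : ℕ) : ℝ) := by exact_mod_cast hc
      _ ≤ (K : ℝ) / k := Nat.cast_div_le
      _ = _ := div_eq_mul_inv _ _
  refine h1.trans ?_
  rw [← Finset.mul_sum]
  have h2 := harmonic_le_one_add_log K
  rw [harmonic_eq_sum_Icc] at h2
  push_cast at h2
  gcongr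

/-- The number of lattice points below a hyperbola. -/
theorem card_le_of_mul_le {x : ℝ} (hx : 1 ≤ x) (S : Finset (ℕ × ℕ))
    (hS : ∀ q ∈ S, 1 ≤ q.1 ∧ 1 ≤ q.2 ∧ (q.1 : ℝ) * q.2 ≤ x) :
    (S.card : ℝ) ≤ x * (1 + Real.log x) := by
  have hK : ((⌊x⌋₊ : ℕ) : ℝ) ≤ x := Nat.floor_le (by linarith)
  have hK1 : 1 ≤ ⌊x⌋₊ := Nat.le_floor (by exact_mod_cast hx)
  have hK1' : (1 : ℝ) ≤ (⌊x⌋₊ : ℕ) := by exact_mod_cast hK1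
  refine (card_le_of_mul_le_nat (K := ⌊x⌋₊) S fun q hq => ?_).trans ?_
  · obtain ⟨h1, h2, h3⟩ := hS q hq
    exact ⟨h1, h2, Nat.le_floor (by exact_mod_cast h3)⟩
  · have : Real.log (⌊x⌋₊ : ℕ) ≤ Real.log x := Real.log_le_log (by linarith) hK
    have : 0 ≤ Real.log (⌊x⌋₊ : ℕ) := Real.log_nonneg hK1'
    gcongr

/-- Hölder's inequality against the constant `1`. It serves both the coefficients of the class
(exponent `s`) and the noise (exponent `p`). -/
theorem sum_le_card_rpow_mul {ι : Type*} (S : Finset ι) (v : ι → ℝ) (hv : ∀ i ∈ S, 0 ≤ v i)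
    {s B : ℝ} (hs : 1 ≤ s) (hB : 0 ≤ B) (h : ∑ i ∈ S, v i ^ s ≤ B ^ s) :
    ∑ i ∈ S, v i ≤ (S.card : ℝ) ^ (1 - 1 / s) * B := by
  have hs0 : 0 < s := by linarith
  refine (Real.rpow_le_rpow_iff (Finset.sum_nonneg hv) (by positivity) hs0).1 ?_
  refine (Real.rpow_sum_le_const_mul_sum_rpow_of_nonneg S hs hv).trans ?_
  rw [Real.mul_rpow (by positivity) hB, ← Real.rpow_mul (by positivity),
    show (1 - 1 / s) * s = s - 1 by field_simp]
  gcongr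

theorem sum_abs_le_of_norm_le {ι : Type*} {p : ℝ≥0∞} (hp : 1 ≤ p) {δ : ℝ}
    (ξ : lp (fun _ : ι => ℝ) p) (hξ : ‖ξ‖ ≤ δ) (S : Finset ι) :
    ∑ i ∈ S, |ξ i| ≤ (S.card : ℝ) ^ (1 - (1 / p).toReal) * δ := by
  have hδ : 0 ≤ δ := by
    have : Fact (1 ≤ p) := ⟨hp⟩
    exact (norm_nonneg _).trans hξ
  rcases eq_or_ne p ⊤ with rfl | hpt
  · simp only [ENNReal.div_top, ENNReal.toReal_zero, sub_zero, Real.rpow_one]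
    rw [← nsmul_eq_mul]
    exact Finset.sum_le_card_nsmul _ _ _ fun i _ =>
      (lp.norm_apply_le_norm ENNReal.top_ne_zero ξ i).trans hξ
  · have h1 : 1 ≤ p.toReal := by
      rw [← ENNReal.toReal_one]
      exact ENNReal.toReal_mono hpt hp
    rw [ENNReal.toReal_div, ENNReal.toReal_one]
    refine sum_le_card_rpow_mul S _ (fun i _ => abs_nonneg _) h1 hδ ?_
    have : Fact (1 ≤ p) := ⟨hp⟩
    refine (lp.sum_rpow_le_norm_rpow (by linarith) ξ S).trans ?_
    gcongr

/-- The sum of the series `∑ 2 (i + 3) 2^{-αi}`. -/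
noncomputable def geomConst (α : ℝ) : ℝ := ∑' i : ℕ, 2 * ((i : ℝ) + 3) * ((2 : ℝ) ^ (-α)) ^ i

theorem summable_geomConst {α : ℝ} (hα : 0 < α) :
    Summable fun i : ℕ => 2 * ((i : ℝ) + 3) * ((2 : ℝ) ^ (-α)) ^ i := by
  have h0 : (0 : ℝ) ≤ (2 : ℝ) ^ (-α) := by positivity
  have h1 : (2 : ℝ) ^ (-α) < 1 := Real.rpow_lt_one_of_one_lt_of_neg (by norm_num) (by linarith)
  have h2 : ‖(2 : ℝ) ^ (-α)‖ < 1 := by rwa [Real.norm_of_nonneg h0]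
  have ha := summable_pow_mul_geometric_of_norm_lt_one 1 h2
  have hb := summable_geometric_of_lt_one h0 h1
  refine ((ha.mul_left 2).add (hb.mul_left 6)).congr fun i => ?_
  simp only [pow_one]
  ring

theorem geomConst_pos {α : ℝ} (hα : 0 < α) : 0 < geomConst α :=
  (summable_geomConst hα).tsum_pos (fun i => by positivity) 0 (by positivity)

/-- Weighted sums of the coefficients beyond a hyperbola. -/
theorem sum_hyperbolic_tail_le {s μ w M : ℝ} (hs : 1 ≤ s) (hα : 0 < μ - w - 1 + 1 / s)
    (hM : 3 ≤ M) (c : ℕ × ℕ → ℝ) (T : Finset (ℕ × ℕ))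
    (hT : ∀ q ∈ T, 1 ≤ q.1 ∧ 1 ≤ q.2 ∧ M ≤ (q.1 : ℝ) * q.2)
    (hc : ∑ q ∈ T, ((q.1 : ℝ) * q.2) ^ (s * μ) * |c q| ^ s ≤ 1) :
    ∑ q ∈ T, |c q| * ((q.1 : ℝ) * q.2) ^ w ≤
      geomConst (μ - w - 1 + 1 / s) *
        (M ^ (-(μ - w - 1 + 1 / s)) * Real.log M ^ (1 - 1 / s)) := by
  have hs0 : 0 < s := by linarith
  have hs1 : 1 / s ≤ 1 := by rw [div_le_one hs0]; exact hs
  have hs2 : 0 < 1 / s := by positivity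
  have hM0 : 0 < M := by linarith
  -- This is what `3 ≤ M` is for: additive constants can be absorbed into `Real.log M`.
  have hlog : 1 ≤ Real.log M := by
    rw [Real.le_log_iff_exp_le hM0]
    exact Real.exp_one_lt_d9.le.trans (by linarith)
  set α := μ - w - 1 + 1 / s with hαdef
  set θ := 1 - 1 / s with hθ
  -- The index of the dyadic block: `e q = i` means `2^i M ≤ kj < 2^{i+1} M`.
  let e : ℕ × ℕ → ℕ := fun q => Nat.log 2 ⌊(q.1 : ℝ) * q.2 / M⌋₊
  have hblock : ∀ i : ℕ, ∑ q ∈ T with e q = i, |c q| * ((q.1 : ℝ) * q.2) ^ w ≤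
      2 * ((i : ℝ) + 3) * ((2 : ℝ) ^ (-α)) ^ i * (M ^ (-α) * Real.log M ^ θ) := by
    intro i
    set B := T.filter fun q => e q = i with hB
    have hBm : ∀ q ∈ B, 1 ≤ q.1 ∧ 1 ≤ q.2 ∧ (2 : ℝ) ^ i * M ≤ (q.1 : ℝ) * q.2 ∧
        (q.1 : ℝ) * q.2 ≤ 2 ^ (i + 1) * M := by
      intro q hq
      obtain ⟨hqT, hqe⟩ := Finset.mem_filter.1 hq
      obtain ⟨h1, h2, h3⟩ := hT q hqT
      have hx : 1 ≤ (q.1 : ℝ) * q.2 / M := by rwa [le_div_iff₀ hM0, one_mul]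
      have hne : ⌊(q.1 : ℝ) * q.2 / M⌋₊ ≠ 0 := by
        have : 1 ≤ ⌊(q.1 : ℝ) * q.2 / M⌋₊ := Nat.le_floor (by exact_mod_cast hx)
        omega
      have ha := Nat.pow_log_le_self 2 hne
      have hb := Nat.lt_pow_succ_log_self (b := 2) (by norm_num) ⌊(q.1 : ℝ) * q.2 / M⌋₊
      change 2 ^ e q ≤ _ at ha
      change _ < 2 ^ (e q + 1) at hb
      rw [hqe] at ha hb
      refine ⟨h1, h2, ?_, ?_⟩
      · rw [← le_div_iff₀ hM0]
        have : ((2 ^ i : ℕ) : ℝ) ≤ _ := Nat.cast_le.2 ha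
        push_cast at this
        exact this.trans (Nat.floor_le (by linarith))
      · rw [← div_le_iff₀ hM0]
        have := (Nat.floor_lt (by linarith)).1 hb
        push_cast at this
        exact this.le
    have hz : (1 : ℝ) ≤ 2 ^ i * M := by
      have : (1 : ℝ) ≤ 2 ^ i := one_le_pow₀ (by norm_num)
      nlinarith
    have hcard : (B.card : ℝ) ≤ (2 ^ i * M) * (2 * ((i : ℝ) + 3)) * Real.log M := by
      have hx : (1 : ℝ) ≤ 2 ^ (i + 1) * M := by rw [pow_succ]; linarith
      refine (card_le_of_mul_le hx B fun q hq => ?_).trans ?_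
      · obtain ⟨h1, h2, -, h4⟩ := hBm q hq
        exact ⟨h1, h2, h4⟩
      · rw [Real.log_mul (by positivity) hM0.ne', Real.log_pow]
        have hl2 : Real.log 2 ≤ 1 := by
          have := Real.log_two_lt_d9
          linarith
        have h5 : 1 + (((i + 1 : ℕ) : ℝ) * Real.log 2 + Real.log M) ≤ (i + 3) * Real.log M := by
          have h6 : ((i + 1 : ℕ) : ℝ) * Real.log 2 ≤ (i + 1 : ℝ) * Real.log M := by
            push_cast
            gcongr
            linarith
          linarith
        calc (2 : ℝ) ^ (i + 1) * M * (1 + (((i + 1 : ℕ) : ℝ) * Real.log 2 + Real.log M))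
            ≤ 2 ^ (i + 1) * M * ((i + 3) * Real.log M) := by gcongr
          _ = _ := by ring
    have hsum : ∑ q ∈ B, |c q| * ((q.1 : ℝ) * q.2) ^ μ ≤ (B.card : ℝ) ^ θ := by
      rw [← mul_one ((B.card : ℝ) ^ θ)]
      refine sum_le_card_rpow_mul B _ (fun q _ => by positivity) hs zero_le_one ?_
      rw [Real.one_rpow]
      refine le_trans ?_ hc
      refine le_trans (le_of_eq ?_) (Finset.sum_le_sum_of_subset_of_nonneg
        (Finset.filter_subset (fun q => e q = i) T) fun q _ _ => by positivity)
      refine Finset.sum_congr rfl fun q _ => ?_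
      rw [Real.mul_rpow (by positivity) (by positivity), ← Real.rpow_mul (by positivity),
        mul_comm μ s, mul_comm]
    calc ∑ q ∈ B, |c q| * ((q.1 : ℝ) * q.2) ^ w
        ≤ ∑ q ∈ B, (2 ^ i * M) ^ (-(α + θ)) * (|c q| * ((q.1 : ℝ) * q.2) ^ μ) := by
          refine Finset.sum_le_sum fun q hq => ?_
          obtain ⟨h1, h2, h3, -⟩ := hBm q hq
          have hq0 : (0 : ℝ) < (q.1 : ℝ) * q.2 := by linarith
          -- Since `w = μ - (α + θ)`, the weight `μ` of the class is split off and the remaining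
          -- negative power is bounded at the lower edge of the block. The count, raised to the
          -- power `θ`, then restores `(2^i M)^θ` and leaves `(2^i M)^{-α}`.
          have : ((q.1 : ℝ) * q.2) ^ w =
              ((q.1 : ℝ) * q.2) ^ (-(α + θ)) * ((q.1 : ℝ) * q.2) ^ μ := by
            rw [← Real.rpow_add hq0]
            congr 1
            rw [hαdef, hθ]; ring
          rw [this, mul_left_comm]
          gcongr ?_ * _
          refine Real.rpow_le_rpow_of_nonpos (by positivity) h3 ?_
          linarith
      _ = (2 ^ i * M) ^ (-(α + θ)) * ∑ q ∈ B, |c q| * ((q.1 : ℝ) * q.2) ^ μ := by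
          rw [Finset.mul_sum]
      _ ≤ (2 ^ i * M) ^ (-(α + θ)) *
            ((2 ^ i * M) * (2 * ((i : ℝ) + 3)) * Real.log M) ^ θ := by
          gcongr
          exact hsum.trans (by gcongr)
      _ = (2 ^ i * M) ^ (-α) * ((2 * ((i : ℝ) + 3)) ^ θ * Real.log M ^ θ) := by
          have hz0 : (0 : ℝ) < 2 ^ i * M := by linarith
          generalize (2 : ℝ) ^ i * M = z at hz0
          rw [mul_assoc z, Real.mul_rpow hz0.le (by positivity),
            Real.mul_rpow (by positivity) (by positivity), ← mul_assoc, ← Real.rpow_add hz0]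
          congr 2
          ring
      -- As `θ ≤ 1`, the factor depending on `i` may be taken linear, which matches the series in
      -- `geomConst`.
      _ ≤ (2 ^ i * M) ^ (-α) * ((2 * ((i : ℝ) + 3)) ^ (1 : ℝ) * Real.log M ^ θ) := by
          gcongr
          · have : (0 : ℝ) ≤ i := by positivity
            linarith
          · linarith
      _ = _ := by
          rw [Real.mul_rpow (by positivity) hM0.le, Real.rpow_one, ← Real.rpow_natCast,
            ← Real.rpow_natCast, ← Real.rpow_mul (by norm_num), ← Real.rpow_mul (by norm_num),
            mul_comm (i : ℝ) (-α)]
          ring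
  rw [← Finset.sum_fiberwise_of_maps_to (t := T.image e)
    (fun q hq => Finset.mem_image_of_mem e hq)]
  refine (Finset.sum_le_sum fun i _ => hblock i).trans ?_
  rw [← Finset.sum_mul]
  gcongr
  exact (summable_geomConst hα).sum_le_tsum _ fun i _ => by positivity

end GalerkinInfo

/-! ### Convergence of the derivative series and the error of the truncation method. -/

namespace GalerkinInfo

theorem normTerm_nonneg (s μ : ℝ) (f : L2Q) (q : ℕ × ℕ) : 0 ≤ normTerm s μ f q := by
  unfold normTerm
  positivity

theorem normTerm_of_one_le {s μ : ℝ} {f : L2Q} {q : ℕ × ℕ} (h1 : 1 ≤ q.1) (h2 : 1 ≤ q.2) :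
    normTerm s μ f q = ((q.1 : ℝ) * q.2) ^ (s * μ) * |coeff f q| ^ s := by
  rw [normTerm, max_eq_right h1, max_eq_right h2]

theorem sum_weighted_coeff_le_one {s μ : ℝ} (hs : 1 ≤ s) {f : L2Q} (hf : f ∈ unitClass s μ)
    (T : Finset (ℕ × ℕ)) (hT : ∀ q ∈ T, 1 ≤ q.1 ∧ 1 ≤ q.2) :
    ∑ q ∈ T, ((q.1 : ℝ) * q.2) ^ (s * μ) * |coeff f q| ^ s ≤ 1 := by
  obtain ⟨hsum, hle⟩ := hf
  have hs0 : 0 < s := by linarith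
  have h1 : ∑' q, normTerm s μ f q ≤ 1 := by
    have h0 : 0 ≤ ∑' q, normTerm s μ f q := tsum_nonneg (normTerm_nonneg s μ f)
    rw [smoothNorm] at hle
    refine (Real.rpow_le_rpow_iff h0 zero_le_one (by positivity : 0 < 1 / s)).1 ?_
    rwa [Real.one_rpow]
  refine le_trans (le_of_eq ?_) ((hsum.sum_le_tsum T fun q _ => normTerm_nonneg s μ f q).trans h1)
  exact Finset.sum_congr rfl fun q hq => (normTerm_of_one_le (hT q hq).1 (hT q hq).2).symm

theorem sum_coeff_tail_le {r : ℕ} (hr : 1 ≤ r) {s μ : ℝ} (hs : 1 ≤ s)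
    (hμ : 2 * (r : ℝ) - 1 / s + 1 / 2 < μ) {f : L2Q} (hf : f ∈ unitClass s μ) {M : ℝ} (hM : 3 ≤ M)
    (T : Finset (ℕ × ℕ)) (hT : ∀ q ∈ T, r ≤ q.1 ∧ r ≤ q.2 ∧ M ≤ (q.1 : ℝ) * q.2) :
    ∑ q ∈ T, |coeff f q| * ((q.1 : ℝ) * q.2) ^ (2 * (r : ℝ) - 1 / 2) ≤
      geomConst (μ - 2 * r + 1 / s - 1 / 2) *
        (M ^ (-(μ - 2 * r + 1 / s - 1 / 2)) * Real.log M ^ (1 - 1 / s)) := by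
  have e : μ - 2 * r + 1 / s - 1 / 2 = μ - (2 * (r : ℝ) - 1 / 2) - 1 + 1 / s := by ring
  rw [e]
  refine sum_hyperbolic_tail_le hs (by linarith) hM _ T (fun q hq => ?_)
    (sum_weighted_coeff_le_one hs hf T fun q hq => ?_)
  · obtain ⟨h1, h2, h3⟩ := hT q hq
    exact ⟨hr.trans h1, hr.trans h2, h3⟩
  · obtain ⟨h1, h2, -⟩ := hT q hq
    exact ⟨hr.trans h1, hr.trans h2⟩

/-- Absolute convergence of the series for the mixed derivative. -/
theorem summable_derivTerm {r : ℕ} (hr : 1 ≤ r) {s μ : ℝ} (hs : 1 ≤ s)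
    (hμ : 2 * (r : ℝ) - 1 / s + 1 / 2 < μ) {f : L2Q} (hf : f ∈ unitClass s μ) :
    Summable (derivTerm r f) := by
  obtain ⟨C, hC, hT⟩ := exists_norm_legendreTensor_le r hr
  set w := 2 * (r : ℝ) - 1 / 2
  let g : ℕ × ℕ → ℝ := fun q => |coeff f q| * ((q.1 : ℝ) * q.2) ^ w
  have hg : ∀ q, 0 ≤ g q := fun q => by positivity
  suffices h : Summable fun q : {q : ℕ × ℕ // r ≤ q.1 ∧ r ≤ q.2} => g q.1 by
    refine Summable.of_norm_bounded (h.mul_left C) fun q => ?_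
    rw [derivTerm, norm_smul, Real.norm_eq_abs]
    calc _ ≤ |coeff f q.1| * (C * ((q.1.1 : ℝ) * q.1.2) ^ w) := by gcongr; exact hT _
      _ = _ := by simp only [g]; ring
  -- The tail estimate starts at `kj ≥ 3`; the finitely many indices with `kj < 3` lie in this box.
  let G := Finset.Icc 1 3 ×ˢ Finset.Icc 1 3
  refine summable_of_sum_le (c := ∑ q ∈ G, g q + geomConst (μ - 2 * r + 1 / s - 1 / 2) *
    ((3 : ℝ) ^ (-(μ - 2 * r + 1 / s - 1 / 2)) * Real.log 3 ^ (1 - 1 / s)))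
    (fun q => hg q.1) fun U => ?_
  have e : ∑ q ∈ U, g q.1 = ∑ q ∈ U.map (Function.Embedding.subtype _), g q := by
    rw [Finset.sum_map]; rfl
  have hU : ∀ q ∈ U.map (Function.Embedding.subtype _), r ≤ q.1 ∧ r ≤ q.2 := by
    intro q hq
    obtain ⟨q', -, rfl⟩ := Finset.mem_map.1 hq
    exact q'.2
  rw [e, ← Finset.sum_filter_add_sum_filter_not _ fun q : ℕ × ℕ => q.1 * q.2 < 3]
  refine add_le_add (Finset.sum_le_sum_of_subset_of_nonneg (fun q hq => ?_) fun q _ _ => hg q)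
    (sum_coeff_tail_le hr hs hμ hf le_rfl _ fun q hq => ?_)
  · obtain ⟨hq, h3⟩ := Finset.mem_filter.1 hq
    obtain ⟨h1, h2⟩ := hU q hq
    simp only [G, Finset.mem_product, Finset.mem_Icc]
    refine ⟨⟨by omega, ?_⟩, ⟨by omega, ?_⟩⟩ <;> nlinarith
  · obtain ⟨hq, h3⟩ := Finset.mem_filter.1 hq
    obtain ⟨h1, h2⟩ := hU q hq
    exact ⟨h1, h2, by exact_mod_cast not_lt.1 h3⟩

/-- The bounds `k, j < n` are redundant: if `k ≥ n` then `kj ≥ nr`, because `j ≥ r`. -/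
theorem mem_hypCross {r n : ℕ} {q : ℕ × ℕ} :
    q ∈ hypCross r n ↔ r ≤ q.1 ∧ r ≤ q.2 ∧ q.1 * q.2 < r * n := by
  simp only [hypCross, Finset.mem_filter, Finset.mem_product, Finset.mem_Ico]
  constructor
  · rintro ⟨⟨⟨h1, -⟩, h2, -⟩, h3⟩
    exact ⟨h1, h2, h3⟩
  · rintro ⟨h1, h2, h3⟩
    refine ⟨⟨⟨h1, ?_⟩, h2, ?_⟩, h3⟩
    · by_contra! h
      have := Nat.mul_le_mul h h2
      rw [mul_comm n r] at this
      omega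
    · by_contra! h
      have := Nat.mul_le_mul h1 h
      omega

theorem card_hypCross_le {r n : ℕ} (hr : 1 ≤ r) (hn : 1 ≤ r * n) :
    ((hypCross r n).card : ℝ) ≤ ((r * n : ℕ) : ℝ) * (1 + Real.log (r * n : ℕ)) := by
  refine card_le_of_mul_le (by exact_mod_cast hn) _ fun q hq => ?_
  obtain ⟨h1, h2, h3⟩ := mem_hypCross.1 hq
  exact ⟨hr.trans h1, hr.trans h2, by exact_mod_cast h3.le⟩

theorem truncation_info (r n : ℕ) (y : ℕ × ℕ → ℝ) :
    truncation r n (info (hypCross r n) y) = ∑ q ∈ hypCross r n, y q • legendreTensor r q :=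
  Finset.sum_coe_sort (hypCross r n) fun q => y q • legendreTensor r q

/-- The error of the truncation method, in terms of the parameter of the hyperbolic cross. -/
theorem exists_algError_truncation_le {r : ℕ} (hr : 1 ≤ r) {s μ : ℝ} (hs : 1 ≤ s)
    (hμ : 2 * (r : ℝ) - 1 / s + 1 / 2 < μ) {p : ℝ≥0∞} (hp : 1 ≤ p) :
    ∃ C : ℝ, 0 < C ∧ ∀ n : ℕ, 3 ≤ r * n → ∀ δ : ℝ, 0 < δ →
      algError r s μ p δ (hypCross r n) (truncation r n) ≤ ENNReal.ofReal (C *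
        (((r * n : ℕ) : ℝ) ^ (-(μ - 2 * r + 1 / s - 1 / 2)) *
            Real.log (r * n : ℕ) ^ (1 - 1 / s) +
          δ * ((r * n : ℕ) : ℝ) ^ (2 * (r : ℝ) - 1 / 2) *
            (((r * n : ℕ) : ℝ) * (1 + Real.log (r * n : ℕ))) ^ (1 - (1 / p).toReal))) := by
  obtain ⟨C, hC, hT⟩ := exists_norm_legendreTensor_le r hr
  have hα : 0 < μ - 2 * r + 1 / s - 1 / 2 := by linarith
  set w := 2 * (r : ℝ) - 1 / 2 with hw
  set K := geomConst (μ - 2 * r + 1 / s - 1 / 2) with hK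
  have hK0 : 0 < K := geomConst_pos hα
  refine ⟨C * (K + 1), by positivity, fun n hn δ hδ => ?_⟩
  have hM : (3 : ℝ) ≤ (r * n : ℕ) := by exact_mod_cast hn
  have hlog0 : 0 ≤ Real.log (r * n : ℕ) := Real.log_nonneg (by linarith)
  have hcard := card_hypCross_le hr (n := n) (by omega)
  set M : ℝ := ((r * n : ℕ) : ℝ) with hMdef
  have hM0 : 0 < M := by linarith
  have hp1 : 0 ≤ 1 - (1 / p).toReal := by
    have : (1 / p).toReal ≤ (1 : ℝ≥0∞).toReal :=
      ENNReal.toReal_mono ENNReal.one_ne_top (by rw [one_div]; exact ENNReal.inv_le_one.2 hp)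
    simpa using this
  have hw0 : 0 ≤ w := by
    have : (1 : ℝ) ≤ r := by exact_mod_cast hr
    rw [hw]; linarith
  refine iSup₂_le fun f hf => iSup₂_le fun y hy => ?_
  obtain ⟨ξ, hξ, hξδ⟩ := hy
  rw [← ofReal_norm]
  refine ENNReal.ofReal_le_ofReal ?_
  have hsum := (summable_derivTerm hr hs hμ hf).hasSum
  rw [truncation_info]
  have hlim := (hsum.sub_const (∑ q ∈ hypCross r n, y q • legendreTensor r q)).norm
  -- It suffices to bound the finite partial sums that contain the whole cross, uniformly, and pass
  -- to the limit.
  refine le_of_tendsto hlim ?_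
  filter_upwards [Filter.eventually_ge_atTop ((hypCross r n).subtype fun q => r ≤ q.1 ∧ r ≤ q.2)]
    with U hU
  set V := U.map (Function.Embedding.subtype _) with hV
  have hsub : hypCross r n ⊆ V := by
    intro q hq
    have h := mem_hypCross.1 hq
    rw [hV, Finset.mem_map]
    exact ⟨⟨q, h.1, h.2.1⟩, hU (Finset.mem_subtype.2 hq), rfl⟩
  have e : ∑ q ∈ U, derivTerm r f q = ∑ q ∈ V, coeff f q • legendreTensor r q := by
    rw [hV, Finset.sum_map]; rfl
  have hterm : ∀ (c : ℝ) (q : ℕ × ℕ),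
      ‖c • legendreTensor r q‖ ≤ C * (|c| * ((q.1 : ℝ) * q.2) ^ w) := by
    intro c q
    rw [norm_smul, Real.norm_eq_abs]
    calc _ ≤ |c| * (C * ((q.1 : ℝ) * q.2) ^ w) := by gcongr; exact hT q
      _ = _ := by ring
  have htail : ‖∑ q ∈ V \ hypCross r n, coeff f q • legendreTensor r q‖ ≤
      C * (K * (M ^ (-(μ - 2 * r + 1 / s - 1 / 2)) * Real.log M ^ (1 - 1 / s))) := by
    refine (norm_sum_le_of_le _ fun q _ => hterm (coeff f q) q).trans ?_
    rw [← Finset.mul_sum]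
    gcongr
    refine sum_coeff_tail_le hr hs hμ hf hM _ fun q hq => ?_
    obtain ⟨hqV, hq⟩ := Finset.mem_sdiff.1 hq
    obtain ⟨q', -, rfl⟩ := Finset.mem_map.1 hqV
    refine ⟨q'.2.1, q'.2.2, ?_⟩
    rw [hMdef]
    have : ¬ q'.1.1 * q'.1.2 < r * n := fun h => hq (mem_hypCross.2 ⟨q'.2.1, q'.2.2, h⟩)
    exact_mod_cast not_lt.1 this
  have hnoise : ‖∑ q ∈ hypCross r n, (coeff f q - y q) • legendreTensor r q‖ ≤
      C * (δ * M ^ w * (M * (1 + Real.log M)) ^ (1 - (1 / p).toReal)) := by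
    refine (norm_sum_le_of_le _ fun q _ => hterm (coeff f q - y q) q).trans ?_
    rw [← Finset.mul_sum]
    gcongr
    calc _ ≤ ∑ q ∈ hypCross r n, |ξ q| * M ^ w := by
            refine Finset.sum_le_sum fun q hq => ?_
            rw [hξ q]
            have h := (mem_hypCross.1 hq).2.2.le
            have : (q.1 : ℝ) * q.2 ≤ M := by rw [hMdef]; exact_mod_cast h
            gcongr
      _ ≤ ((M * (1 + Real.log M)) ^ (1 - (1 / p).toReal) * δ) * M ^ w := by
            rw [← Finset.sum_mul]
            gcongr
            refine (sum_abs_le_of_norm_le hp ξ hξδ _).trans ?_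
            gcongr
      _ = _ := by ring
  -- Truncation error outside the cross plus noise on the cross.
  have hsplit : ∑ q ∈ U, derivTerm r f q - ∑ q ∈ hypCross r n, y q • legendreTensor r q =
      ∑ q ∈ V \ hypCross r n, coeff f q • legendreTensor r q +
        ∑ q ∈ hypCross r n, (coeff f q - y q) • legendreTensor r q := by
    rw [e, ← Finset.sum_sdiff hsub, add_sub_assoc, ← Finset.sum_sub_distrib]
    simp only [sub_smul]
  rw [hsplit]
  refine (norm_add_le_of_le htail hnoise).trans ?_
  have h1 : 0 ≤ M ^ (-(μ - 2 * r + 1 / s - 1 / 2)) * Real.log M ^ (1 - 1 / s) := by positivity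
  have h2 : 0 ≤ δ * M ^ w * (M * (1 + Real.log M)) ^ (1 - (1 / p).toReal) := by positivity
  generalize M ^ (-(μ - 2 * r + 1 / s - 1 / 2)) * Real.log M ^ (1 - 1 / s) = u at h1 ⊢
  generalize δ * M ^ w * (M * (1 + Real.log M)) ^ (1 - (1 / p).toReal) = v at h2 ⊢
  have h3 : 0 ≤ C * u := by positivity
  have h4 : 0 ≤ C * K * v := by positivity
  linarith

end GalerkinInfo

/-! ### The lower bound: functions invisible to the information. -/

section

open Polynomial

namespace GalerkinInfo

theorem mixedDeriv_neg (r : ℕ) (f : L2Q) : mixedDeriv r (-f) = -mixedDeriv r f := by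
  rw [mixedDeriv, mixedDeriv, ← tsum_neg]
  simp only [derivTerm, coeff_neg, neg_smul]

theorem neg_mem_unitClass {s μ : ℝ} {f : L2Q} (hf : f ∈ unitClass s μ) : -f ∈ unitClass s μ := by
  have h : normTerm s μ (-f) = normTerm s μ f := by
    funext q
    rw [normTerm, normTerm, coeff_neg, abs_neg]
  simpa only [unitClass, space, smoothNorm, Set.mem_ofPred_eq, h] using hf

theorem isPerturbation_self {p : ℝ≥0∞} (hp : 1 ≤ p) {δ : ℝ} (hδ : 0 ≤ δ) (x : ℕ × ℕ → ℝ) :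
    IsPerturbation p δ x x := by
  have : Fact (1 ≤ p) := ⟨hp⟩
  exact ⟨0, fun q => by simp, by simpa using hδ⟩

/-- An element of the class on which the information vanishes bounds the error from below. -/
theorem le_algError {r : ℕ} {s μ : ℝ} {p : ℝ≥0∞} (hp : 1 ≤ p) {δ : ℝ} (hδ : 0 ≤ δ)
    {Ω : Finset (ℕ × ℕ)} (ψ : (Ω → ℝ) → L2Q) {f : L2Q} (hf : f ∈ unitClass s μ)
    (h0 : ∀ q ∈ Ω, coeff f q = 0) :
    ENNReal.ofReal ‖mixedDeriv r f‖ ≤ algError r s μ p δ Ω ψ := by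
  have hle : ∀ g ∈ unitClass s μ, (∀ q ∈ Ω, coeff g q = 0) →
      ENNReal.ofReal ‖mixedDeriv r g - ψ 0‖ ≤ algError r s μ p δ Ω ψ := by
    intro g hg hg0
    have hi : info Ω (coeff g) = 0 := funext fun q => hg0 q q.2
    rw [ofReal_norm, ← hi]
    exact le_iSup₂_of_le g hg (le_iSup₂_of_le (coeff g) (isPerturbation_self hp hδ _) le_rfl)
  have h1 := hle f hf h0
  have h2 := hle (-f) (neg_mem_unitClass hf) fun q hq => by rw [coeff_neg, h0 q hq, neg_zero]
  rw [mixedDeriv_neg] at h2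
  -- Both `f` and `-f` receive the answer `ψ 0`, and their derivatives are `2‖f^{(r,r)}‖` apart, so
  -- one of the two errors is at least `‖f^{(r,r)}‖`.
  have h3 : ‖mixedDeriv r f‖ + ‖mixedDeriv r f‖ ≤
      ‖mixedDeriv r f - ψ 0‖ + ‖-mixedDeriv r f - ψ 0‖ := by
    calc _ = ‖(mixedDeriv r f - ψ 0) - (-mixedDeriv r f - ψ 0)‖ := by
          rw [show (mixedDeriv r f - ψ 0) - (-mixedDeriv r f - ψ 0) =
            (2 : ℝ) • mixedDeriv r f by rw [two_smul]; abel, norm_smul]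
          norm_num
          ring
      _ ≤ _ := norm_sub_le _ _
  rcases le_total ‖mixedDeriv r f‖ ‖mixedDeriv r f - ψ 0‖ with h | h
  · exact (ENNReal.ofReal_le_ofReal h).trans h1
  · exact (ENNReal.ofReal_le_ofReal (by linarith)).trans h2

theorem normTerm_sum {s μ : ℝ} (hs : 0 < s) {t : ℝ} (A : Finset (ℕ × ℕ))
    (q : ℕ × ℕ) : normTerm s μ (∑ a ∈ A, t • legendreTensor 0 a) q =
      if q ∈ A then ((max 1 q.1 : ℕ) * (max 1 q.2 : ℕ) : ℝ) ^ (s * μ) * |t| ^ s else 0 := by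
  rw [normTerm, coeff_sum]
  split_ifs
  · rfl
  · rw [abs_zero, Real.zero_rpow hs.ne', mul_zero]

theorem sum_mem_unitClass {s μ : ℝ} (hs : 0 < s) {t : ℝ} (A : Finset (ℕ × ℕ))
    (h : ∑ q ∈ A, ((max 1 q.1 : ℕ) * (max 1 q.2 : ℕ) : ℝ) ^ (s * μ) * |t| ^ s ≤ 1) :
    ∑ a ∈ A, t • legendreTensor 0 a ∈ unitClass s μ := by
  have hsum : HasSum (normTerm s μ (∑ a ∈ A, t • legendreTensor 0 a))
      (∑ q ∈ A, ((max 1 q.1 : ℕ) * (max 1 q.2 : ℕ) : ℝ) ^ (s * μ) * |t| ^ s) := by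
    have := hasSum_sum_of_ne_finset_zero (L := .unconditional _) (f := normTerm s μ (∑ a ∈ A, t • legendreTensor 0 a))
      (s := A) fun q hq => by rw [normTerm_sum hs, if_neg hq]
    convert! this using 1
    exact Finset.sum_congr rfl fun q hq => by rw [normTerm_sum hs, if_pos hq]
  refine ⟨hsum.summable, ?_⟩
  rw [smoothNorm, hsum.tsum_eq]
  exact Real.rpow_le_one (Finset.sum_nonneg fun q _ => by positivity) h (by positivity)

theorem mixedDeriv_sum {r : ℕ} {t : ℝ} (A : Finset (ℕ × ℕ)) (hA : ∀ q ∈ A, r ≤ q.1 ∧ r ≤ q.2) :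
    mixedDeriv r (∑ a ∈ A, t • legendreTensor 0 a) = ∑ a ∈ A, t • legendreTensor r a := by
  rw [mixedDeriv, tsum_eq_sum (s := A.subtype fun q => r ≤ q.1 ∧ r ≤ q.2)]
  · simp only [derivTerm]
    rw [Finset.sum_subtype_of_mem
      (fun q => coeff (∑ a ∈ A, t • legendreTensor 0 a) q • legendreTensor r q) hA]
    exact Finset.sum_congr rfl fun q hq => by rw [coeff_sum, if_pos hq]
  · intro q hq
    rw [derivTerm, coeff_sum, if_neg (fun h => hq (Finset.mem_subtype.2 h)), zero_smul]

/-- Lower bound of the norm of a sum of derivatives of Legendre polynomials over a strip. -/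
theorem norm_sum_legendreTensor_ge {r N n : ℕ} (A : Finset ℕ) (hn : 0 < n)
    (hA : ∀ k ∈ A, N + r ≤ k ∧ k < n) (hcard : N ≤ A.card) :
    (N : ℝ) * (Real.sqrt N * ((N : ℝ) ^ (2 * r) / (r.factorial * 2 ^ r))) / n *
        Real.sqrt (intI (derivative^[r] (legendre r) * derivative^[r] (legendre r))) ≤
      ‖∑ a ∈ A, legendreTensor r (a, r)‖ := by
  set D := intI (derivative^[r] (legendre r) * derivative^[r] (legendre r)) with hD
  set P := ∑ k ∈ A, derivative^[r] (legendre k) with hP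
  have hD0 : 0 ≤ D := intI_mul_self_nonneg _
  have hdeg : P.degree < n := by
    refine (degree_lt_iff_coeff_zero _ _).2 fun m hm => ?_
    rw [hP, finsetSum_coeff]
    refine Finset.sum_eq_zero fun k hk => ?_
    have := (hA k hk).2
    rw [coeff_iterate_derivative, coeff_legendre_of_lt (by omega), smul_zero]
  have hnorm : ‖∑ a ∈ A, legendreTensor r (a, r)‖ ^ 2 = intI (P * P) * D := by
    rw [← real_inner_self_eq_norm_sq, sum_inner]
    simp only [inner_sum, inner_legendreTensor]
    rw [hP, Finset.sum_mul_sum, map_sum, Finset.sum_mul]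
    refine Finset.sum_congr rfl fun k _ => ?_
    rw [map_sum, Finset.sum_mul]
  set v := Real.sqrt N * ((N : ℝ) ^ (2 * r) / (r.factorial * 2 ^ r)) with hv
  have hv0 : 0 ≤ v := by positivity
  -- All the endpoint values are positive and at least `v`, so nothing cancels in the sum.
  have heval : (N : ℝ) * v ≤ P.eval 1 := by
    rw [hP, eval_finsetSum]
    calc (N : ℝ) * v ≤ (A.card : ℝ) * v := by gcongr
      _ = ∑ k ∈ A, v := by rw [Finset.sum_const, nsmul_eq_mul]
      _ ≤ _ := Finset.sum_le_sum fun k hk => le_eval_one_iterate_derivative_legendre (hA k hk).1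
  have hN := sq_eval_one_le hdeg
  refine abs_le_of_sq_le_sq' ?_ (norm_nonneg _) |>.2
  rw [hnorm, mul_pow, Real.sq_sqrt hD0, div_pow]
  gcongr
  have hn0 : (0 : ℝ) < n := by exact_mod_cast hn
  rw [div_le_iff₀ (by positivity)]
  have h1 : ((N : ℝ) * v) ^ 2 ≤ P.eval 1 ^ 2 := by gcongr
  have h2 : 0 ≤ (n : ℝ) ^ 2 * intI (P * P) := mul_nonneg (by positivity) (intI_mul_self_nonneg _)
  nlinarith

/-- A positive value at `1` excludes zero norm, by Nikolskii's inequality. -/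
theorem intI_iterate_derivative_legendre_self_pos (r : ℕ) :
    0 < intI (derivative^[r] (legendre r) * derivative^[r] (legendre r)) := by
  have hdeg : (derivative^[r] (legendre r)).degree < (r + 1 : ℕ) := by
    refine (degree_lt_iff_coeff_zero _ _).2 fun m hm => ?_
    rw [coeff_iterate_derivative, coeff_legendre_of_lt (by omega), smul_zero]
  have h := sq_eval_one_le hdeg
  have h1 : 0 < (derivative^[r] (legendre r)).eval 1 := by
    rw [eval_one_iterate_derivative_legendre, Nat.descFactorial_self]
    have : 0 < (r + r).choose r := Nat.choose_pos (by omega)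
    positivity
  by_contra! h2
  have : (((r + 1 : ℕ) : ℝ) ^ 2 / 2) *
      intI (derivative^[r] (legendre r) * derivative^[r] (legendre r)) ≤ 0 :=
    mul_nonpos_of_nonneg_of_nonpos (by positivity) h2
  have h3 : 0 < (derivative^[r] (legendre r)).eval 1 ^ 2 := by positivity
  linarith

/-- The strip has `2N` columns and `Ω` meets at most `N` of them. All its indices are of order `N`,
as Nikolskii's inequality and the normalisation both require. -/
theorem exists_strip_disjoint (r N : ℕ) (Ω : Finset (ℕ × ℕ)) (hΩ : Ω.card ≤ N) :
    ∃ A : Finset ℕ, (∀ k ∈ A, N + r ≤ k ∧ k < 3 * N + r) ∧ N ≤ A.card ∧ A.card ≤ 2 * N ∧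
      ∀ k ∈ A, (k, r) ∉ Ω := by
  refine ⟨Finset.Ico (N + r) (3 * N + r) \ Ω.image Prod.fst, fun k hk => ?_, ?_, ?_, ?_⟩
  · exact Finset.mem_Ico.1 (Finset.mem_sdiff.1 hk).1
  · have h1 := Finset.le_card_sdiff (Ω.image Prod.fst) (Finset.Ico (N + r) (3 * N + r))
    have h2 : (Ω.image Prod.fst).card ≤ Ω.card := Finset.card_image_le
    rw [Nat.card_Ico] at h1
    omega
  · refine (Finset.card_le_card Finset.sdiff_subset).trans ?_
    rw [Nat.card_Ico]
    omega
  · intro k hk h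
    exact (Finset.mem_sdiff.1 hk).2 (Finset.mem_image.2 ⟨_, h, rfl⟩)

/-- The lower bound of the minimal radius. -/
theorem exists_le_minimalRadius {r : ℕ} (hr : 1 ≤ r) {s μ : ℝ} (hs : 1 ≤ s)
    (hμ : 0 < μ) {p : ℝ≥0∞} (hp : 1 ≤ p) :
    ∃ c : ℝ, 0 < c ∧ ∀ N : ℕ, 1 ≤ N → ∀ δ : ℝ, 0 < δ →
      ENNReal.ofReal (c * lowerInN r s μ N) ≤ minimalRadius r s μ p δ N := by
  have hs0 : 0 < s := by linarith
  have hr0 : (1 : ℝ) ≤ r := by exact_mod_cast hr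
  set D := intI (derivative^[r] (legendre r) * derivative^[r] (legendre r)) with hD
  have hD0 : 0 < D := intI_iterate_derivative_legendre_self_pos r
  obtain ⟨R, hRdef⟩ : ∃ R : ℝ, R = (3 + r) * r := ⟨_, rfl⟩
  have hR : 0 < R := by rw [hRdef]; positivity
  refine ⟨2 ^ (-(1 / s)) * R ^ (-μ) * (((r.factorial : ℝ) * 2 ^ r)⁻¹ / (3 + r) * Real.sqrt D),
    by positivity, fun N hN δ hδ => ?_⟩
  have hN0 : (1 : ℝ) ≤ N := by exact_mod_cast hN
  refine le_iInf fun Ω => le_iInf fun _ => le_iInf fun hcard => le_iInf fun ψ => ?_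
  obtain ⟨A, hA, hA1, hA2, hAΩ⟩ := exists_strip_disjoint r N Ω hcard
  have hn : ((3 * N + r : ℕ) : ℝ) ≤ (3 + r) * N := by
    push_cast
    nlinarith
  -- Normalisation: at most `2N` terms, each with `kr ≤ RN`, so the `s`-th power of the norm is at
  -- most `2N (RN)^{sμ} t^s = 1`.
  set t : ℝ := (2 * N : ℝ) ^ (-(1 / s)) * (R * N) ^ (-μ) with ht
  have ht0 : 0 < t := by positivity
  let emb : ℕ ↪ ℕ × ℕ := ⟨fun k => (k, r), fun _ _ h => (Prod.ext_iff.1 h).1⟩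
  have hmem : ∀ q ∈ A.map emb, r ≤ q.1 ∧ r ≤ q.2 := by
    intro q hq
    obtain ⟨k, hk, rfl⟩ := Finset.mem_map.1 hq
    have := (hA k hk).1
    exact ⟨show r ≤ k by omega, le_rfl⟩
  have hclass : ∑ a ∈ A.map emb, t • legendreTensor 0 a ∈ unitClass s μ := by
    refine sum_mem_unitClass hs0 _ ?_
    have hts : |t| ^ s = (2 * N : ℝ)⁻¹ * (R * N) ^ (-(s * μ)) := by
      rw [abs_of_pos ht0, ht, Real.mul_rpow (by positivity) (by positivity),
        ← Real.rpow_mul (by positivity), ← Real.rpow_mul (by positivity),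
        show -(1 / s) * s = -1 by field_simp, Real.rpow_neg_one]
      congr 2
      ring
    calc _ ≤ ∑ q ∈ A.map emb, (R * N) ^ (s * μ) * |t| ^ s := by
          refine Finset.sum_le_sum fun q hq => ?_
          obtain ⟨h1, h2⟩ := hmem q hq
          obtain ⟨k, hk, rfl⟩ := Finset.mem_map.1 hq
          rw [max_eq_right (hr.trans h1), max_eq_right (hr.trans h2)]
          have h3 : (k : ℝ) ≤ ((3 * N + r : ℕ) : ℝ) := by exact_mod_cast (hA k hk).2.le
          have h4 : (k : ℝ) * r ≤ R * N := by
            calc (k : ℝ) * r ≤ ((3 + r) * N) * r := by gcongr; exact h3.trans hn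
              _ = R * N := by rw [hRdef]; ring
          change ((k : ℝ) * r) ^ (s * μ) * _ ≤ _
          gcongr
      _ = (A.card : ℝ) * ((R * N) ^ (s * μ) * |t| ^ s) := by
          rw [Finset.sum_const, nsmul_eq_mul, Finset.card_map]
      _ ≤ (2 * N : ℝ) * ((R * N) ^ (s * μ) * |t| ^ s) := by
          gcongr
          exact_mod_cast hA2
      _ = 1 := by
          rw [hts, Real.rpow_neg (by positivity)]
          have : (R * N) ^ (s * μ) ≠ 0 := by positivity
          field_simp
  refine le_trans (ENNReal.ofReal_le_ofReal ?_) (le_algError hp hδ.le ψ hclass fun q hq => ?_)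
  · rw [mixedDeriv_sum _ hmem, Finset.sum_map, ← Finset.smul_sum, norm_smul, Real.norm_eq_abs,
      abs_of_pos ht0]
    have h := norm_sum_legendreTensor_ge (r := r) A (by omega) hA hA1
    refine le_trans ?_ (mul_le_mul_of_nonneg_left h ht0.le)
    have hNpos : (0 : ℝ) < N := by linarith
    have e : lowerInN r s μ N = (N : ℝ) ^ (-(1 / s)) * (N : ℝ) ^ (-μ) *
        ((N : ℝ) * (Real.sqrt N * (N : ℝ) ^ (2 * r)) / N) := by
      rw [mul_div_cancel_left₀ _ hNpos.ne', Real.sqrt_eq_rpow, ← Real.rpow_natCast,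
        ← Real.rpow_add hNpos, ← Real.rpow_add hNpos, ← Real.rpow_add hNpos, lowerInN]
      congr 1
      push_cast
      ring
    rw [e, ht, Real.mul_rpow (by positivity) (by positivity),
      Real.mul_rpow (by positivity) (by positivity)]
    calc _ = 2 ^ (-(1 / s)) * (N : ℝ) ^ (-(1 / s)) * (R ^ (-μ) * (N : ℝ) ^ (-μ)) *
          ((N : ℝ) * (Real.sqrt N * ((N : ℝ) ^ (2 * r) / (r.factorial * 2 ^ r))) /
            ((3 + r) * N) * Real.sqrt D) := by
          field_simp
      _ ≤ _ := by gcongr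
  · rw [coeff_sum, if_neg]
    intro h
    obtain ⟨k, hk, rfl⟩ := Finset.mem_map.1 h
    exact hAΩ k hk hq

end GalerkinInfo

end

/-! ### Asymptotics as `δ → 0`: balancing the errors and comparing the scales. -/

section

open Filter Topology

namespace GalerkinInfo

/-- The quantity `(δ⁻¹ ln^e (1/δ))^{1/κ}`. -/
noncomputable def powerOrder (κ e δ : ℝ) : ℝ := (δ⁻¹ * Real.log (1 / δ) ^ e) ^ (1 / κ)

theorem tendsto_log_one_div : Tendsto (fun δ : ℝ => Real.log (1 / δ)) (𝓝[>] 0) atTop := by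
  simp only [one_div]
  exact Real.tendsto_log_atTop.comp tendsto_inv_nhdsGT_zero

theorem eventually_le_log_one_div (B : ℝ) : ∀ᶠ δ : ℝ in 𝓝[>] 0, B ≤ Real.log (1 / δ) :=
  tendsto_log_one_div.eventually_ge_atTop B

theorem exists_threshold {P : ℝ → Prop} (h : ∀ᶠ δ in 𝓝[>] (0 : ℝ), P δ) :
    ∃ δ₀ : ℝ, 0 < δ₀ ∧ δ₀ < 1 ∧ ∀ δ : ℝ, 0 < δ → δ ≤ δ₀ → P δ := by
  obtain ⟨u, hu, hsub⟩ := mem_nhdsGT_iff_exists_Ioc_subset.1 h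
  refine ⟨min u (1 / 2), lt_min hu (by norm_num), (min_le_right _ _).trans_lt (by norm_num),
    fun δ h0 h1 => hsub ⟨h0, h1.trans (min_le_left _ _)⟩⟩

/-- Quantities of the order of `powerOrder` are large, with logarithm of the order `ln (1/δ)`. -/
theorem eventually_powerOrder {κ : ℝ} (hκ : 0 < κ) (e B : ℝ) {a b : ℝ} (ha : 0 < a) (hb : 0 < b) :
    ∀ᶠ δ : ℝ in 𝓝[>] 0, 0 < powerOrder κ e δ ∧
      (∀ x, a * powerOrder κ e δ ≤ x → B ≤ x ∧ Real.log (1 / δ) / (4 * κ) ≤ Real.log x) ∧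
      (∀ x, 0 < x → x ≤ b * powerOrder κ e δ → Real.log x ≤ 4 / κ * Real.log (1 / δ)) := by
  -- With `L = ln (1/δ)`, `ln L = o(L)` makes `|e ln L| ≤ L/2`, so the logarithm of `powerOrder`
  -- lies between `L/(2κ)` and `3L/(2κ)`.
  have hlog : ∀ᶠ δ : ℝ in 𝓝[>] 0,
      ‖Real.log (Real.log (1 / δ))‖ ≤ (1 / (2 * (|e| + 1))) * ‖Real.log (1 / δ)‖ := by
    have h := (Real.isLittleO_log_id_atTop.comp_tendsto tendsto_log_one_div).def
      (c := 1 / (2 * (|e| + 1))) (by positivity)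
    simpa only [Function.comp_def, id] using h
  filter_upwards [self_mem_nhdsWithin, hlog, eventually_le_log_one_div 1,
    eventually_le_log_one_div (4 * κ * |Real.log a|), eventually_le_log_one_div (κ * |Real.log b|),
    eventually_le_log_one_div (4 * κ * B)] with δ hδ h1 hL ha1 hb1 hB
  have hδ0 : 0 < δ := hδ
  have hLdef : Real.log δ⁻¹ = Real.log (1 / δ) := by rw [one_div]
  obtain ⟨L, hLe⟩ : ∃ L, L = Real.log (1 / δ) := ⟨_, rfl⟩
  have hYe : powerOrder κ e δ = (δ⁻¹ * L ^ e) ^ (1 / κ) := by rw [powerOrder, hLe]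
  rw [← hLe] at h1 hL ha1 hb1 hB hLdef ⊢
  have hL0 : 0 < L := by linarith
  have hY : 0 < powerOrder κ e δ := by rw [hYe]; positivity
  have hlogY : Real.log (powerOrder κ e δ) = (L + e * Real.log L) / κ := by
    rw [hYe, Real.log_rpow (by positivity), Real.log_mul (by positivity) (by positivity),
      Real.log_rpow hL0, hLdef]
    ring
  have he : |e * Real.log L| ≤ L / 2 := by
    rw [Real.norm_eq_abs, Real.norm_of_nonneg hL0.le] at h1
    rw [abs_mul]
    calc |e| * |Real.log L| ≤ (|e| + 1) * (1 / (2 * (|e| + 1)) * L) := by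
          gcongr
          linarith
      _ = L / 2 := by field_simp
  obtain ⟨he1, he2⟩ := abs_le.1 he
  have hY1 : L / (2 * κ) ≤ Real.log (powerOrder κ e δ) := by
    rw [hlogY, div_le_div_iff₀ (by positivity) hκ]
    nlinarith
  have hY2 : Real.log (powerOrder κ e δ) ≤ 3 * L / (2 * κ) := by
    rw [hlogY, div_le_div_iff₀ hκ (by positivity)]
    nlinarith
  have ha2 : |Real.log a| ≤ L / (4 * κ) := by rw [le_div_iff₀ (by positivity)]; linarith
  have hb2 : |Real.log b| ≤ L / κ := by rw [le_div_iff₀ (by positivity)]; linarith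
  have hB2 : B ≤ L / (4 * κ) := by rw [le_div_iff₀ (by positivity)]; linarith
  refine ⟨hY, fun x hx => ?_, fun x hx0 hx => ?_⟩
  · have hx0 : 0 < x := lt_of_lt_of_le (by positivity) hx
    have h2 : L / (4 * κ) ≤ Real.log x := by
      calc L / (4 * κ) = -(L / (4 * κ)) + L / (2 * κ) := by field_simp; ring
        _ ≤ Real.log a + Real.log (powerOrder κ e δ) := by
            have := (abs_le.1 ha2).1
            linarith
        _ = Real.log (a * powerOrder κ e δ) := (Real.log_mul ha.ne' hY.ne').symm
        _ ≤ Real.log x := Real.log_le_log (by positivity) hx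
    refine ⟨?_, h2⟩
    have := Real.log_le_sub_one_of_pos hx0
    linarith
  · calc Real.log x ≤ Real.log (b * powerOrder κ e δ) := Real.log_le_log hx0 hx
      _ = Real.log b + Real.log (powerOrder κ e δ) := Real.log_mul hb.ne' hY.ne'
      _ ≤ L / κ + 3 * L / (2 * κ) := by
          have := (abs_le.1 hb2).2
          linarith
      _ ≤ 4 / κ * L := by
          have : 0 ≤ L / κ := by positivity
          have e1 : 3 * L / (2 * κ) = 3 / 2 * (L / κ) := by field_simp
          have e2 : 4 / κ * L = 4 * (L / κ) := by field_simp
          rw [e1, e2]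
          linarith

theorem powerOrder_rpow {κ e δ : ℝ} (hκ : κ ≠ 0) (hδ : 0 < δ) (hL : 0 < Real.log (1 / δ)) :
    powerOrder κ e δ ^ κ = δ⁻¹ * Real.log (1 / δ) ^ e := by
  rw [powerOrder, ← Real.rpow_mul (by positivity), one_div_mul_cancel hκ, Real.rpow_one]

theorem powerOrder_rpow_neg {κ e e' α δ : ℝ} (he : e' = -e) (hδ : 0 < δ)
    (hL : 0 < Real.log (1 / δ)) :
    powerOrder κ e δ ^ (-α) = (δ * Real.log (1 / δ) ^ e') ^ (α / κ) := by
  have h : δ * Real.log (1 / δ) ^ e' = (δ⁻¹ * Real.log (1 / δ) ^ e)⁻¹ := by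
    rw [he, Real.rpow_neg hL.le, mul_inv, inv_inv]
  rw [h, powerOrder, ← Real.rpow_mul (by positivity), Real.inv_rpow (by positivity),
    ← Real.rpow_neg (by positivity)]
  congr 1
  ring

/-- The logarithmic exponents of the two scales differ by exactly `κ`, so the root of order `κ`
leaves one factor `ln (1/δ)`, the same one that separates `n` from the size bound `n ln n` of the
cross. -/
theorem orderN_eq {s μ : ℝ} {p : ℝ≥0∞} {δ : ℝ} (hκ : 0 < kappa s μ p) (hδ : 0 < δ)
    (hL : 0 < Real.log (1 / δ)) :
    orderN s μ p δ = orderTrunc s μ p δ * Real.log (1 / δ) := by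
  have e : μ = ((1 / p).toReal - 1 / s) + kappa s μ p := by rw [kappa]; ring
  have h : Real.log (1 / δ) ^ μ =
      Real.log (1 / δ) ^ ((1 / p).toReal - 1 / s) * Real.log (1 / δ) ^ kappa s μ p := by
    rw [← Real.rpow_add hL, ← e]
  rw [orderN, orderTrunc, h, ← mul_assoc, Real.mul_rpow (by positivity) (by positivity),
    ← Real.rpow_mul hL.le, mul_one_div_cancel hκ.ne', Real.rpow_one]

theorem toReal_one_div_le_one {p : ℝ≥0∞} (hp : 1 ≤ p) : (1 / p).toReal ≤ 1 := by
  have : (1 / p).toReal ≤ (1 : ℝ≥0∞).toReal :=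
    ENNReal.toReal_mono ENNReal.one_ne_top (by rw [one_div]; exact ENNReal.inv_le_one.2 hp)
  simpa using this

theorem upperInDelta_eq {r : ℕ} {s μ : ℝ} {p : ℝ≥0∞} {δ : ℝ} (hδ : 0 < δ)
    (hL : 0 < Real.log (1 / δ)) :
    upperInDelta r s μ p δ = orderTrunc s μ p δ ^ (-(μ - 2 * r + 1 / s - 1 / 2)) *
      Real.log (1 / δ) ^ (3 / 2 - 1 / s) := by
  change _ = powerOrder (kappa s μ p) ((1 / p).toReal - 1 / s) δ ^ _ * _
  rw [upperInDelta, powerOrder_rpow_neg (neg_sub (1 / p).toReal (1 / s)).symm hδ hL]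

theorem lowerInDelta_eq {r : ℕ} {s μ : ℝ} {p : ℝ≥0∞} {δ : ℝ} (hδ : 0 < δ)
    (hL : 0 < Real.log (1 / δ)) :
    lowerInDelta r s μ p δ = orderN s μ p δ ^ (-(μ - 2 * r + 1 / s - 1 / 2)) := by
  change _ = powerOrder (kappa s μ p) μ δ ^ _
  rw [lowerInDelta, powerOrder_rpow_neg rfl hδ hL]

/-- Balance of the two parts of the error of the truncation method. -/
theorem eventually_truncation_error_le {r : ℕ} (hr : 1 ≤ r) {s μ : ℝ} (hs : 1 ≤ s) {p : ℝ≥0∞}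
    (hp : 1 ≤ p) (hα : 0 < μ - 2 * r + 1 / s - 1 / 2) (hκ : 0 < kappa s μ p) {a b : ℝ}
    (ha : 0 < a) (hb : 0 < b) :
    ∃ C : ℝ, 0 < C ∧ ∀ᶠ δ : ℝ in 𝓝[>] 0, ∀ x : ℝ,
      a * orderTrunc s μ p δ ≤ x → x ≤ b * orderTrunc s μ p δ →
      3 ≤ x ∧ x ^ (-(μ - 2 * r + 1 / s - 1 / 2)) * Real.log x ^ (1 - 1 / s) +
          δ * x ^ (2 * (r : ℝ) - 1 / 2) * (x * (1 + Real.log x)) ^ (1 - (1 / p).toReal) ≤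
        C * upperInDelta r s μ p δ := by
  have hs0 : 0 < s := by linarith
  have hs1 : 1 / s ≤ 1 := by rw [div_le_one hs0]; exact hs
  have hp1 := toReal_one_div_le_one hp
  have hr1 : (1 : ℝ) ≤ r := by exact_mod_cast hr
  obtain ⟨κ, hκe⟩ : ∃ κ, κ = kappa s μ p := ⟨_, rfl⟩
  obtain ⟨π, hπ⟩ : ∃ π, π = (1 / p).toReal := ⟨_, rfl⟩
  obtain ⟨σ, hσ⟩ : ∃ σ, σ = 1 / s := ⟨_, rfl⟩
  have hκ' : κ = μ - π + σ := by rw [hκe, kappa, hπ, hσ]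
  rw [← hπ] at hp1
  rw [← hσ] at hs1 hα
  rw [← hκe] at hκ
  obtain ⟨α, hαe⟩ : ∃ α, α = μ - 2 * r + σ - 1 / 2 := ⟨_, rfl⟩
  rw [← hαe] at hα
  obtain ⟨w, hw⟩ : ∃ w, w = 2 * (r : ℝ) - 1 / 2 := ⟨_, rfl⟩
  have hw0 : 0 ≤ w + (1 - π) := by linarith
  refine ⟨a ^ (-α) * (4 / κ) ^ (1 - σ) + b ^ (w + (1 - π)) * (1 + 4 / κ) ^ (1 - π),
    by positivity, ?_⟩
  filter_upwards [self_mem_nhdsWithin, eventually_le_log_one_div 1,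
    eventually_powerOrder hκ (π - σ) 3 ha hb] with δ hδ hL ⟨hY0, hlow, hup⟩ x hax hxb
  have hδ0 : 0 < δ := hδ
  have hL0 : 0 < Real.log (1 / δ) := by linarith
  have hYκ := powerOrder_rpow (e := π - σ) hκ.ne' hδ0 hL0
  have hYe : orderTrunc s μ p δ = powerOrder κ (π - σ) δ := by
    rw [orderTrunc, powerOrder, hκe, hπ, hσ]
  rw [upperInDelta_eq hδ0 hL0, hYe, ← hσ, ← hπ, ← hαe, ← hw]
  rw [hYe] at hax hxb
  generalize powerOrder κ (π - σ) δ = Y at *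
  generalize Real.log (1 / δ) = L at *
  obtain ⟨hx3, hxlow⟩ := hlow x hax
  have hx0 : 0 < x := by linarith
  have hxup := hup x hx0 hxb
  have hlogx : 0 ≤ Real.log x := le_trans (by positivity) hxlow
  refine ⟨hx3, ?_⟩
  -- Both parts of the error come out with the power `1 - 1/s` of the logarithm; the target exponent
  -- `3/2 - 1/s` leaves a margin of `L^{1/2}`.
  have hLmono : L ^ (1 - σ) ≤ L ^ (3 / 2 - σ) :=
    Real.rpow_le_rpow_of_exponent_le hL (by linarith)
  have h1 : x ^ (-α) * Real.log x ^ (1 - σ) ≤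
      a ^ (-α) * (4 / κ) ^ (1 - σ) * (Y ^ (-α) * L ^ (3 / 2 - σ)) := by
    calc x ^ (-α) * Real.log x ^ (1 - σ) ≤ (a * Y) ^ (-α) * (4 / κ * L) ^ (1 - σ) := by
          refine mul_le_mul (Real.rpow_le_rpow_of_nonpos (by positivity) hax (by linarith)) ?_
            (by positivity) (by positivity)
          exact Real.rpow_le_rpow hlogx hxup (by linarith)
      _ = a ^ (-α) * (4 / κ) ^ (1 - σ) * (Y ^ (-α) * L ^ (1 - σ)) := by
          rw [Real.mul_rpow ha.le hY0.le, Real.mul_rpow (by positivity) hL0.le]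
          ring
      _ ≤ _ := by gcongr
  -- Eliminating `δ` makes the balance visible: `w + (1 - π) - κ = -α`, and the logarithmic
  -- exponents add up to `1 - σ`.
  have hδY : δ = Y ^ (-κ) * L ^ (π - σ) := by
    rw [Real.rpow_neg hY0.le, hYκ]
    field_simp
  have h2 : δ * x ^ w * (x * (1 + Real.log x)) ^ (1 - π) ≤
      b ^ (w + (1 - π)) * (1 + 4 / κ) ^ (1 - π) * (Y ^ (-α) * L ^ (3 / 2 - σ)) := by
    have hlog1 : 1 + Real.log x ≤ (1 + 4 / κ) * L := by linarith
    calc δ * x ^ w * (x * (1 + Real.log x)) ^ (1 - π)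
        = δ * (x ^ (w + (1 - π)) * (1 + Real.log x) ^ (1 - π)) := by
          rw [Real.mul_rpow hx0.le (by positivity), Real.rpow_add hx0]
          ring
      _ ≤ δ * ((b * Y) ^ (w + (1 - π)) * ((1 + 4 / κ) * L) ^ (1 - π)) := by
          have hb' : 0 ≤ 1 - π := by linarith
          gcongr
      _ = b ^ (w + (1 - π)) * (1 + 4 / κ) ^ (1 - π) *
            ((Y ^ (-κ) * Y ^ (w + (1 - π))) * (L ^ (π - σ) * L ^ (1 - π))) := by
          rw [Real.mul_rpow hb.le hY0.le, Real.mul_rpow (by positivity) hL0.le, hδY]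
          ring
      _ = b ^ (w + (1 - π)) * (1 + 4 / κ) ^ (1 - π) * (Y ^ (-α) * L ^ (1 - σ)) := by
          rw [← Real.rpow_add hY0, ← Real.rpow_add hL0]
          congr 3
          · rw [hκ', hw, hαe]; ring
          · ring
      _ ≤ _ := by gcongr
  linarith

/-- Comparison of the bounds in terms of `δ` and of `N`. -/
theorem eventually_compare_bounds {r : ℕ} {s μ : ℝ} (hs : 1 ≤ s) {p : ℝ≥0∞}
    (hα : 0 < μ - 2 * r + 1 / s - 1 / 2) (hκ : 0 < kappa s μ p) {a b : ℝ}
    (ha : 0 < a) (hb : 0 < b) :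
    ∃ C : ℝ, 0 < C ∧ ∀ᶠ δ : ℝ in 𝓝[>] 0, ∀ N : ℕ,
      a * orderN s μ p δ ≤ N → (N : ℝ) ≤ b * orderN s μ p δ →
      1 ≤ N ∧ lowerInDelta r s μ p δ ≤ C * lowerInN r s μ N ∧
        upperInDelta r s μ p δ ≤ C * upperInN r s μ N := by
  have hs0 : 0 < s := by linarith
  have hs1 : 1 / s ≤ 1 := by rw [div_le_one hs0]; exact hs
  obtain ⟨κ, hκe⟩ : ∃ κ, κ = kappa s μ p := ⟨_, rfl⟩
  obtain ⟨α, hαe⟩ : ∃ α, α = μ - 2 * r + 1 / s - 1 / 2 := ⟨_, rfl⟩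
  obtain ⟨γ, hγ⟩ : ∃ γ, γ = μ - 2 * r + 1 := ⟨_, rfl⟩
  have hγα : γ = α + (3 / 2 - 1 / s) := by rw [hγ, hαe]; ring
  rw [← hαe] at hα
  have hγ0 : 0 < γ := by linarith
  refine ⟨b ^ α + b ^ α * (4 * κ) ^ γ, ?_, ?_⟩
  · rw [hκe]; positivity
  filter_upwards [self_mem_nhdsWithin, eventually_le_log_one_div 1,
    eventually_powerOrder hκ μ 1 ha hb] with δ hδ hL ⟨hX0, hlow, _⟩ N hax hxb
  have hδ0 : 0 < δ := hδ
  have hL0 : 0 < Real.log (1 / δ) := by linarith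
  change 0 < orderN s μ p δ at hX0
  obtain ⟨hN1, hNlog⟩ := hlow N hax
  have hN0 : (0 : ℝ) < N := by linarith
  have hX := orderN_eq hκ hδ0 hL0
  have hY0 : 0 < orderTrunc s μ p δ := by
    rw [hX] at hX0
    exact pos_of_mul_pos_left hX0 hL0.le
  have hexp : -μ + 2 * (r : ℝ) - 1 / s + 1 / 2 = -α := by rw [hαe]; ring
  have h1 : orderN s μ p δ ^ (-α) ≤ b ^ α * (N : ℝ) ^ (-α) := by
    calc orderN s μ p δ ^ (-α) = b ^ α * (b * orderN s μ p δ) ^ (-α) := by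
          rw [Real.mul_rpow hb.le hX0.le, ← mul_assoc, ← Real.rpow_add hb]
          simp
      _ ≤ _ := by
          gcongr ?_ * ?_
          exact Real.rpow_le_rpow_of_nonpos hN0 hxb (by linarith)
  rw [lowerInDelta_eq hδ0 hL0, upperInDelta_eq hδ0 hL0, lowerInN, upperInN, hexp, ← hαe, ← hγ]
  rw [← hκe] at hNlog hκ
  refine ⟨by exact_mod_cast hN1, ?_, ?_⟩
  · have : 0 ≤ b ^ α * (4 * κ) ^ γ * (N : ℝ) ^ (-α) := by positivity
    linarith
  · have h2 : Real.log (1 / δ) ^ γ ≤ (4 * κ) ^ γ * Real.log N ^ γ := by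
      rw [← Real.mul_rpow (by positivity) (le_trans (by positivity) hNlog)]
      refine Real.rpow_le_rpow hL0.le ?_ hγ0.le
      rw [div_le_iff₀ (by positivity)] at hNlog
      linarith
    have h3 : 0 ≤ b ^ α * ((N : ℝ) ^ (-α) * Real.log N ^ γ) := by
      have : 0 ≤ Real.log N := le_trans (by positivity) hNlog
      positivity
    -- Replacing `Y` by `X / L` contributes `L^α`, and `α + 3/2 - 1/s = μ - 2r + 1` is the exponent
    -- of the logarithm in `upperInN`.
    calc orderTrunc s μ p δ ^ (-α) * Real.log (1 / δ) ^ (3 / 2 - 1 / s)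
        = orderN s μ p δ ^ (-α) * Real.log (1 / δ) ^ γ := by
          rw [hX, Real.mul_rpow hY0.le hL0.le, mul_assoc, ← Real.rpow_add hL0]
          congr 2
          rw [hγα]; ring
      _ ≤ (b ^ α * (N : ℝ) ^ (-α)) * ((4 * κ) ^ γ * Real.log N ^ γ) := by gcongr
      _ = b ^ α * (4 * κ) ^ γ * ((N : ℝ) ^ (-α) * Real.log N ^ γ) := by ring
      _ ≤ _ := by linarith

/-- The hyperbolic cross has at most `N` elements if its parameter is small enough. -/
theorem eventually_card_hypCross_le {r : ℕ} (hr : 1 ≤ r) {s μ : ℝ} {p : ℝ≥0∞}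
    (hκ : 0 < kappa s μ p) {a : ℝ} (ha : 0 < a) :
    ∃ a' b' : ℝ, 0 < a' ∧ a' ≤ b' ∧ ∀ᶠ δ : ℝ in 𝓝[>] 0,
      (∃ n : ℕ, a' * orderTrunc s μ p δ ≤ n ∧ (n : ℝ) ≤ b' * orderTrunc s μ p δ) ∧
      ∀ n : ℕ, a' * orderTrunc s μ p δ ≤ n → (n : ℝ) ≤ b' * orderTrunc s μ p δ →
        ((hypCross r n).card : ℝ) ≤ a * orderN s μ p δ := by
  have hr0 : (0 : ℝ) < r := by exact_mod_cast hr
  set κ := kappa s μ p with hκe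
  -- Chosen so that the size bound `rn (1 + ln (rn))` at `n = b'Y` is at most `aX`. The lower end
  -- `b'/2` leaves room for the floor of `b'Y` once `b'Y ≥ 2`.
  set b' : ℝ := a / (r * (1 + 4 / κ)) with hb'
  have hb0 : 0 < b' := by positivity
  refine ⟨b' / 2, b', by positivity, by linarith, ?_⟩
  filter_upwards [self_mem_nhdsWithin, eventually_le_log_one_div 1,
    eventually_powerOrder hκ ((1 / p).toReal - 1 / s) 2 hb0 (mul_pos hr0 hb0),
    eventually_powerOrder hκ ((1 / p).toReal - 1 / s) 1 (half_pos hb0) hb0]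
    with δ hδ hL ⟨hY0, hlow, hup⟩ ⟨_, hlow', _⟩
  have hδ0 : 0 < δ := hδ
  have hL0 : 0 < Real.log (1 / δ) := by linarith
  have hX := orderN_eq hκ hδ0 hL0
  change 0 < orderTrunc s μ p δ at hY0
  change ∀ x, b' * orderTrunc s μ p δ ≤ x → _ at hlow
  change ∀ x, b' / 2 * orderTrunc s μ p δ ≤ x → _ at hlow'
  change ∀ x, 0 < x → x ≤ r * b' * orderTrunc s μ p δ → _ at hup
  refine ⟨⟨⌊b' * orderTrunc s μ p δ⌋₊, ?_, Nat.floor_le (by positivity)⟩, fun n hn1 hn2 => ?_⟩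
  · have h2 := (hlow _ le_rfl).1
    have h3 := Nat.lt_floor_add_one (b' * orderTrunc s μ p δ)
    linarith
  · have hn : (1 : ℝ) ≤ n := (hlow' n hn1).1
    have hn' : 1 ≤ n := by exact_mod_cast hn
    have hrn : ((r * n : ℕ) : ℝ) ≤ r * b' * orderTrunc s μ p δ := by
      push_cast
      rw [mul_assoc]
      gcongr
    have hrn1 : 1 ≤ r * n := Nat.mul_pos hr hn'
    have hlog := hup (r * n : ℕ) (by exact_mod_cast hrn1) hrn
    calc _ ≤ ((r * n : ℕ) : ℝ) * (1 + Real.log (r * n : ℕ)) := card_hypCross_le hr hrn1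
      _ ≤ (r * b' * orderTrunc s μ p δ) * ((1 + 4 / κ) * Real.log (1 / δ)) := by
          have : 0 ≤ Real.log (r * n : ℕ) := Real.log_nonneg (by exact_mod_cast hrn1)
          gcongr
          linarith
      _ = a * orderN s μ p δ := by
          rw [hX, hb']
          field_simp

theorem minimalRadius_le_algError {r n N : ℕ} {s μ : ℝ} {p : ℝ≥0∞} {δ : ℝ}
    (hcard : (hypCross r n).card ≤ N) :
    minimalRadius r s μ p δ N ≤ algError r s μ p δ (hypCross r n) (truncation r n) :=
  iInf_le_of_le (hypCross r n) <|
    iInf_le_of_le (fun _ hq => ⟨(mem_hypCross.1 hq).1, (mem_hypCross.1 hq).2.1⟩) <|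
      iInf_le_of_le hcard <| iInf_le _ (truncation r n)

theorem kappa_pos {r : ℕ} (hr : 1 ≤ r) {s μ : ℝ} (hμ : 2 * (r : ℝ) - 1 / s + 1 / 2 < μ)
    {p : ℝ≥0∞} (hp : 1 ≤ p) : 0 < kappa s μ p := by
  have := toReal_one_div_le_one hp
  have hr1 : (1 : ℝ) ≤ r := by exact_mod_cast hr
  rw [kappa]
  linarith

/-- The accuracy of the truncation method with a parameter of the order `orderTrunc`. -/
theorem eventually_algError_truncation_le {r : ℕ} (hr : 1 ≤ r) {s μ : ℝ} (hs : 1 ≤ s)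
    (hμ : 2 * (r : ℝ) - 1 / s + 1 / 2 < μ) {p : ℝ≥0∞} (hp : 1 ≤ p) {a b : ℝ} (ha : 0 < a)
    (hb : 0 < b) :
    ∃ C : ℝ, 0 < C ∧ ∀ᶠ δ : ℝ in 𝓝[>] 0, ∀ n : ℕ,
      a * orderTrunc s μ p δ ≤ n → (n : ℝ) ≤ b * orderTrunc s μ p δ →
      algError r s μ p δ (hypCross r n) (truncation r n) ≤
        ENNReal.ofReal (C * upperInDelta r s μ p δ) := by
  have hr0 : (0 : ℝ) < r := by exact_mod_cast hr
  obtain ⟨C₁, hC₁, h₁⟩ := exists_algError_truncation_le hr hs hμ hp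
  obtain ⟨C₂, hC₂, h₂⟩ := eventually_truncation_error_le hr hs hp (by linarith)
    (kappa_pos hr hμ hp) (mul_pos hr0 ha) (mul_pos hr0 hb)
  refine ⟨C₁ * C₂, by positivity, ?_⟩
  filter_upwards [self_mem_nhdsWithin, h₂] with δ hδ h n hn1 hn2
  obtain ⟨h3, hle⟩ := h (r * n : ℕ) (by push_cast; rw [mul_assoc]; gcongr)
    (by push_cast; rw [mul_assoc]; gcongr)
  refine (h₁ n (by exact_mod_cast h3) δ hδ).trans (ENNReal.ofReal_le_ofReal ?_)
  rw [mul_assoc C₁ C₂]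
  gcongr

/-- The accuracy of the truncation method in terms of the number of coefficients. -/
theorem eventually_algError_truncation_le_upperInN {r : ℕ} (hr : 1 ≤ r) {s μ : ℝ} (hs : 1 ≤ s)
    (hμ : 2 * (r : ℝ) - 1 / s + 1 / 2 < μ) {p : ℝ≥0∞} (hp : 1 ≤ p) {a b : ℝ} (ha : 0 < a)
    (hb : 0 < b) :
    ∃ a' b' C : ℝ, 0 < a' ∧ a' ≤ b' ∧ 0 < C ∧ ∀ᶠ δ : ℝ in 𝓝[>] 0,
      (∃ n : ℕ, a' * orderTrunc s μ p δ ≤ n ∧ (n : ℝ) ≤ b' * orderTrunc s μ p δ) ∧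
      ∀ N : ℕ, a * orderN s μ p δ ≤ N → (N : ℝ) ≤ b * orderN s μ p δ →
        ∀ n : ℕ, a' * orderTrunc s μ p δ ≤ n → (n : ℝ) ≤ b' * orderTrunc s μ p δ →
          (hypCross r n).card ≤ N ∧
          algError r s μ p δ (hypCross r n) (truncation r n) ≤
            ENNReal.ofReal (C * upperInN r s μ N) := by
  have hκ := kappa_pos hr hμ hp
  obtain ⟨a', b', ha', hab', hcard⟩ := eventually_card_hypCross_le hr hκ ha
  obtain ⟨C₁, hC₁, h₁⟩ := eventually_algError_truncation_le hr hs hμ hp ha' (ha'.trans_le hab')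
  obtain ⟨C₂, hC₂, h₂⟩ := eventually_compare_bounds (r := r) hs (by linarith) hκ ha hb
  refine ⟨a', b', C₁ * C₂, ha', hab', by positivity, ?_⟩
  filter_upwards [hcard, h₁, h₂] with δ ⟨hex, hc⟩ hd he
  refine ⟨hex, fun N hN1 hN2 n hn1 hn2 => ⟨by exact_mod_cast (hc n hn1 hn2).trans hN1, ?_⟩⟩
  refine (hd n hn1 hn2).trans (ENNReal.ofReal_le_ofReal ?_)
  have := (he N hN1 hN2).2.2
  rw [mul_assoc]
  gcongr

end GalerkinInfo

end

/-! ### Assembly of the theorem. -/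

theorem theorem5 (r : ℕ) (hr : 1 ≤ r) (s μ : ℝ) (hs : 1 ≤ s)
    (hμ : 2 * (r : ℝ) - 1 / s + 1 / 2 < μ) (p : ℝ≥0∞) (hp : 1 ≤ p) :
    -- on the class the series defining the derivative converges in the space `L₂(Q)`
    (∀ f ∈ GalerkinInfo.unitClass s μ, Summable (GalerkinInfo.derivTerm r f)) ∧
    -- two-sided estimates of the minimal radius, in terms of `N` and in terms of `δ`
    (∀ a b : ℝ, 0 < a → a ≤ b →
      ∃ c C δ₀ : ℝ, 0 < c ∧ 0 < C ∧ 0 < δ₀ ∧ δ₀ < 1 ∧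
        ∀ δ : ℝ, 0 < δ → δ ≤ δ₀ → ∀ N : ℕ,
          a * GalerkinInfo.orderN s μ p δ ≤ N → (N : ℝ) ≤ b * GalerkinInfo.orderN s μ p δ →
          (ENNReal.ofReal (c * GalerkinInfo.lowerInN r s μ N) ≤
              GalerkinInfo.minimalRadius r s μ p δ N ∧
            GalerkinInfo.minimalRadius r s μ p δ N ≤
              ENNReal.ofReal (C * GalerkinInfo.upperInN r s μ N)) ∧
          (ENNReal.ofReal (c * GalerkinInfo.lowerInDelta r s μ p δ) ≤
              GalerkinInfo.minimalRadius r s μ p δ N ∧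
            GalerkinInfo.minimalRadius r s μ p δ N ≤
              ENNReal.ofReal (C * GalerkinInfo.upperInDelta r s μ p δ))) ∧
    -- every choice of `n` of the indicated order gives the truncation method the accuracy
    -- of the upper bound
    (∀ a b : ℝ, 0 < a → a ≤ b →
      ∃ C δ₀ : ℝ, 0 < C ∧ 0 < δ₀ ∧ δ₀ < 1 ∧
        ∀ δ : ℝ, 0 < δ → δ ≤ δ₀ → ∀ n : ℕ,
          a * GalerkinInfo.orderTrunc s μ p δ ≤ n →
          (n : ℝ) ≤ b * GalerkinInfo.orderTrunc s μ p δ →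
          GalerkinInfo.algError r s μ p δ (GalerkinInfo.hypCross r n)
              (GalerkinInfo.truncation r n) ≤
            ENNReal.ofReal (C * GalerkinInfo.upperInDelta r s μ p δ)) ∧
    -- for `N` of the indicated order, the upper bound is realized, using at most `N`
    -- coefficients, by the truncation method with `n` of the indicated order
    (∀ a b : ℝ, 0 < a → a ≤ b →
      ∃ a' b' C δ₀ : ℝ, 0 < a' ∧ a' ≤ b' ∧ 0 < C ∧ 0 < δ₀ ∧ δ₀ < 1 ∧
        ∀ δ : ℝ, 0 < δ → δ ≤ δ₀ →
          (∃ n : ℕ, a' * GalerkinInfo.orderTrunc s μ p δ ≤ n ∧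
            (n : ℝ) ≤ b' * GalerkinInfo.orderTrunc s μ p δ) ∧
          ∀ N : ℕ,
            a * GalerkinInfo.orderN s μ p δ ≤ N → (N : ℝ) ≤ b * GalerkinInfo.orderN s μ p δ →
            ∀ n : ℕ,
              a' * GalerkinInfo.orderTrunc s μ p δ ≤ n →
              (n : ℝ) ≤ b' * GalerkinInfo.orderTrunc s μ p δ →
              (GalerkinInfo.hypCross r n).card ≤ N ∧
              GalerkinInfo.algError r s μ p δ (GalerkinInfo.hypCross r n)
                  (GalerkinInfo.truncation r n) ≤
                ENNReal.ofReal (C * GalerkinInfo.upperInN r s μ N)) := by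
  have hκ := GalerkinInfo.kappa_pos hr hμ hp
  refine ⟨fun f hf => GalerkinInfo.summable_derivTerm hr hs hμ hf, fun a b ha hab => ?_,
    fun a b ha hab => ?_, fun a b ha hab => ?_⟩
  · have hb := ha.trans_le hab
    have hr1 : (1 : ℝ) ≤ r := by exact_mod_cast hr
    have hs1 : 1 / s ≤ 1 := by rw [div_le_one (by linarith)]; exact hs
    obtain ⟨c, hc, hlow⟩ := GalerkinInfo.exists_le_minimalRadius (μ := μ) hr hs (by linarith) hp
    obtain ⟨C₁, hC₁, h₁⟩ :=
      GalerkinInfo.eventually_compare_bounds (r := r) hs (by linarith) hκ ha hb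
    obtain ⟨a', b', C₂, ha', hab', hC₂, h₂⟩ :=
      GalerkinInfo.eventually_algError_truncation_le_upperInN hr hs hμ hp ha hb
    obtain ⟨C₃, hC₃, h₃⟩ :=
      GalerkinInfo.eventually_algError_truncation_le hr hs hμ hp ha' (ha'.trans_le hab')
    obtain ⟨δ₀, h0, h1, hδ₀⟩ := GalerkinInfo.exists_threshold (h₁.and (h₂.and h₃))
    -- The constant `c / C₁` converts the lower bound in `N` into the one in `δ`. A single `n`,
    -- small enough that the cross has at most `N` points, serves both upper bounds.
    refine ⟨min c (c / C₁), max C₂ C₃, δ₀, by positivity, by positivity, h0, h1,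
      fun δ hδ hle N hN1 hN2 => ?_⟩
    obtain ⟨hcomp, ⟨⟨n, hn1, hn2⟩, hupN⟩, hupδ⟩ := hδ₀ δ hδ hle
    obtain ⟨hN, hlδ, -⟩ := hcomp N hN1 hN2
    obtain ⟨hcard, hN3⟩ := hupN N hN1 hN2 n hn1 hn2
    have hL : 0 < Real.log (1 / δ) :=
      Real.log_pos ((one_lt_div hδ).2 (hle.trans_lt h1))
    have hl0 : 0 ≤ GalerkinInfo.lowerInN r s μ N := by
      unfold GalerkinInfo.lowerInN; positivity
    have hl1 : 0 ≤ GalerkinInfo.lowerInDelta r s μ p δ := by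
      unfold GalerkinInfo.lowerInDelta; positivity
    have hu0 : 0 ≤ GalerkinInfo.upperInN r s μ N := by
      have : 0 ≤ Real.log N := Real.log_natCast_nonneg N
      unfold GalerkinInfo.upperInN; positivity
    have hu1 : 0 ≤ GalerkinInfo.upperInDelta r s μ p δ := by
      unfold GalerkinInfo.upperInDelta; positivity
    have hmin := GalerkinInfo.minimalRadius_le_algError (s := s) (μ := μ) (p := p) (δ := δ) hcard
    refine ⟨⟨le_trans (ENNReal.ofReal_le_ofReal ?_) (hlow N hN δ hδ),
      (hmin.trans hN3).trans (ENNReal.ofReal_le_ofReal ?_)⟩,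
      ⟨le_trans (ENNReal.ofReal_le_ofReal ?_) (hlow N hN δ hδ),
      (hmin.trans (hupδ n hn1 hn2)).trans (ENNReal.ofReal_le_ofReal ?_)⟩⟩
    · gcongr; exact min_le_left _ _
    · gcongr; exact le_max_left _ _
    · calc _ ≤ c / C₁ * (C₁ * GalerkinInfo.lowerInN r s μ N) := by
            gcongr; exact min_le_right _ _
        _ = _ := by field_simp
    · gcongr; exact le_max_right _ _
  · obtain ⟨C, hC, h⟩ :=
      GalerkinInfo.eventually_algError_truncation_le hr hs hμ hp ha (ha.trans_le hab)
    obtain ⟨δ₀, h0, h1, hδ₀⟩ := GalerkinInfo.exists_threshold h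
    exact ⟨C, δ₀, hC, h0, h1, hδ₀⟩
  · obtain ⟨a', b', C, ha', hab', hC, h⟩ :=
      GalerkinInfo.eventually_algError_truncation_le_upperInN hr hs hμ hp ha (ha.trans_le hab)
    obtain ⟨δ₀, h0, h1, hδ₀⟩ := GalerkinInfo.exists_threshold h
    exact ⟨a', b', C, δ₀, ha', hab', hC, h0, h1, hδ₀⟩
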